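/- Let $\mathbb K\in\{\mathbb R,\mathbb C\}$. Smooth maps between open subsets of locally convex Hausdorff $\mathbb K$-spaces are understood in the Michal–Bastiani sense ($f$ is $C^{1}$ if it is continuous and its directional derivatives $df(x)(h)$ exist and are jointly continuous in $(x,h)$; $f$ is $C^{n+1}$ if it is $C^1$ and $df$ is $C^n$; smooth means $C^n$ for all $n$), and a Lie group is a group which is a smooth manifold modeled on a locally convex Hausdorff space with smooth multiplication and inversion. Let $G$ and $N$ be Lie groups, $\mathrm{Aut}(N)$ the group of Lie group automorphisms of $N$, and $C_N(n)(x)=nxn^{-1}$. *Cochains.* $C^1_s(G,N)$ is the set of maps $h:G\to N$ with $h(1)=1$ that are smooth on an open identity neighborhood. $C^2_{ss}(G,N)$ is the set of maps $\omega:G\times G\to N$ that are smooth on an open identity neighborhood, satisfy $\omega(g,1)=\omega(1,g)=1$ for all $g$, and for which each map $x\mapsto \omega(g,x)\,\omega(gxg^{-1},g)^{-1}$, $g\in G$, is smooth on an identity neighborhood of $G$. $C^1_s(G,\mathrm{Aut}(N))$ is the set of maps $S:G\to\mathrm{Aut}(N)$ with $S(1)=\mathrm{id}_N$ such that $(g,n)\mapsto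 S(g)(n)$ is smooth on $U\times N$ for some open identity neighborhood $U\subseteq G$. The set $Z^2_{ss}(G,N)$ of smooth factor systems consists of the pairs $(S,\omega)\in C^1_s(G,\mathrm{Aut}(N))\times C^2_{ss}(G,N)$ with $$S(g)S(g')S(gg')^{-1}=C_N(\omega(g,g')),\qquad S(g)(\omega(g',g''))\,\omega(g,g'g'')\,\omega(gg',g'')^{-1}\,\omega(g,g')^{-1}=1 .$$ *Extensions.* A Lie group extension of $G$ by $N$ is a short exact sequence $1\to N\xrightarrow{\iota}\widehat G\xrightarrow{q}G\to1$ of Lie group morphisms that makes $\widehat G$ a smooth $N$-principal bundle over $G$ (every $g\in G$ has an open neighborhood $U$ with a smooth section $\sigma:U\to\widehat G$ of $q$ such that $(x,n)\mapsto\sigma(x)\iota(n)$ is a diffeomorphism $U\times N\to q^{-1}(U)$). An equivalence from $\widehat G_1$ to $\widehat G_2$ is a Lie group morphism $\varphi:\widehat G_1\to\widehat G_2$ with $\varphi\circ\iota_1=\iota_2$ and $q_2\circ\varphi=q_1$; the existence of one is an equivalence relation on extensions, and $\mathrm{Ext}(G,N)$ is the set of equivalence classes. For $(S,\omega)\in Z^2_{ss}(G,N)$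 let $N\times_{(S,\omega)}G$ be the set $N\times G$ with the group multiplication $$(n,g)(n',g')=(n\,S(g)(n')\,\omega(g,g'),\,gg').$$ It carries a unique Lie group structure for which, for some open identity neighborhood $U\subseteq G$, the map $(n,g)\mapsto(n,g)$ is a diffeomorphism of the open subset $N\times U$ of the product manifold onto an open subset of $N\times_{(S,\omega)}G$. With this structure, $n\mapsto(n,1)$ and $(n,g)\mapsto g$, it is a Lie group extension of $G$ by $N$. **Theorem.** $C^1_s(G,N)$ is a group under pointwise multiplication, and it acts on $Z^2_{ss}(G,N)$ by $$h.(S,\omega)=(h.S,\;h*_S\omega),\qquad (h.S)(g)=C_N(h(g))\,S(g),\qquad (h*_S\omega)(g,g')=h(g)\,S(g)(h(g'))\,\omega(g,g')\,h(gg')^{-1}.$$ (a) For $(S,\omega),(S',\omega')\in Z^2_{ss}(G,N)$, the extensions $N\times_{(S,\omega)}G$ and $N\times_{(S',\omega')}G$ are equivalent if and only if there is $h\in C^1_s(G,N)$ with $h.(S,\omega)=(S',\omega')$. (b) If $h\in C^1_s(G,N)$ satisfies $h.(S,\omega)=(S',\omega')$, then $$\varphi: N\times_{(S',\omega')}G\to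 N\times_{(S,\omega)}G,\qquad \varphi(n,g)=(n\,h(g),g),$$ is an equivalence of extensions; and every equivalence of extensions $N\times_{(S',\omega')}G\to N\times_{(S,\omega)}G$ has this form for some such $h$. (c) The map $Z^2_{ss}(G,N)\to\mathrm{Ext}(G,N)$, $(S,\omega)\mapsto[N\times_{(S,\omega)}G]$, induces a bijection $Z^2_{ss}(G,N)/C^1_s(G,N)\to\mathrm{Ext}(G,N)$. -/

import Mathlib

open Set Filter Topology

universe w w₁ w₂ w₃ u v

/-! ### Smooth maps between locally convex spaces (Michal-Bastiani calculus) -/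

/-- `f` is of class `C^n` on the open set `U`: it is continuous on `U` and, if `n = m + 1`, all
directional derivatives `df (x, h) = lim_{t → 0} t⁻¹ (f (x + t h) - f x)`, `x ∈ U`, exist and
`df` is of class `C^m` on `U × X`. -/
def MBContDiffOn (𝕜 : Type w) [RCLike 𝕜] {Y : Type w₂} [AddCommGroup Y] [Module 𝕜 Y]
    [TopologicalSpace Y] : (n : ℕ) → {X : Type w₁} → [AddCommGroup X] → [Module 𝕜 X] →
    [TopologicalSpace X] → (X → Y) → Set X → Prop
  | 0, _, _, _, _, f, U => ContinuousOn f U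
  | n + 1, X, _, _, _, f, U => ContinuousOn f U ∧ ∃ df : X × X → Y,
      (∀ x ∈ U, ∀ h : X,
        Tendsto (fun t : 𝕜 => t⁻¹ • (f (x + t • h) - f x)) (𝓝[≠] 0) (𝓝 (df (x, h)))) ∧
      MBContDiffOn 𝕜 n df (U ×ˢ univ)

/-- `f` is smooth on the open set `U` if it is of class `C^n` there for all `n`. -/
def MBSmoothOn (𝕜 : Type w) [RCLike 𝕜] {X : Type w₁} [AddCommGroup X] [Module 𝕜 X]
    [TopologicalSpace X] {Y : Type w₂} [AddCommGroup Y] [Module 𝕜 Y] [TopologicalSpace Y]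
    (f : X → Y) (U : Set X) : Prop :=
  ∀ n : ℕ, MBContDiffOn 𝕜 n f U

/-! ### Smooth manifolds and Lie groups modeled on locally convex spaces -/

/-- The charted space `M` is a smooth manifold: all changes of charts are smooth. -/
def IsMBManifold (𝕜 : Type w) [RCLike 𝕜] (E : Type w₁) [AddCommGroup E] [Module 𝕜 E]
    [TopologicalSpace E] (M : Type u) [TopologicalSpace M] [ChartedSpace E M] : Prop :=
  ∀ e ∈ atlas E M, ∀ e' ∈ atlas E M, MBSmoothOn 𝕜 (e.symm.trans e') (e.symm.trans e').source

/-- The product charts on a product of two charted spaces, with values in the product of the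
models. -/
instance prodChartedSpaceProd (E : Type w₁) [TopologicalSpace E] (M : Type u) [TopologicalSpace M]
    [ChartedSpace E M] (F : Type w₂) [TopologicalSpace F] (M' : Type v) [TopologicalSpace M']
    [ChartedSpace F M'] : ChartedSpace (E × F) (M × M') :=
  prodChartedSpace E M F M'

/-- The map `f` between charted spaces is smooth on the open set `s`: it is continuous there and
all its expressions in charts are smooth. -/
def ManSmoothOn (𝕜 : Type w) [RCLike 𝕜] (E : Type w₁) [AddCommGroup E] [Module 𝕜 E]
    [TopologicalSpace E] (F : Type w₂) [AddCommGroup F] [Module 𝕜 F] [TopologicalSpace F]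
    {M : Type u} [TopologicalSpace M] [ChartedSpace E M]
    {M' : Type v} [TopologicalSpace M'] [ChartedSpace F M'] (f : M → M') (s : Set M) : Prop :=
  ContinuousOn f s ∧ ∀ e ∈ atlas E M, ∀ e' ∈ atlas F M',
    MBSmoothOn 𝕜 (fun x => e' (f (e.symm x))) (e.target ∩ e.symm ⁻¹' (s ∩ f ⁻¹' e'.source))

/-- `f` restricts to a diffeomorphism from the open set `s` onto the open set `t`. -/
def IsDiffeoOn (𝕜 : Type w) [RCLike 𝕜] (E : Type w₁) [AddCommGroup E] [Module 𝕜 E]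
    [TopologicalSpace E] (F : Type w₂) [AddCommGroup F] [Module 𝕜 F] [TopologicalSpace F]
    {M : Type u} [TopologicalSpace M] [ChartedSpace E M]
    {M' : Type v} [TopologicalSpace M'] [ChartedSpace F M'] (f : M → M')
    (s : Set M) (t : Set M') : Prop :=
  IsOpen s ∧ IsOpen t ∧ BijOn f s t ∧ ManSmoothOn 𝕜 E F f s ∧
    ∃ f' : M' → M, InvOn f' f s t ∧ ManSmoothOn 𝕜 F E f' t

/-- `G` is a Lie group modeled on the topological vector space `E`. -/
class IsMBLieGroup (𝕜 : Type w) [RCLike 𝕜] (E : Type w₁) [AddCommGroup E] [Module 𝕜 E]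
    [TopologicalSpace E] (G : Type u) [Group G] [TopologicalSpace G] [ChartedSpace E G] :
    Prop where
  isManifold : IsMBManifold 𝕜 E G
  smooth_mul : ManSmoothOn 𝕜 (E × E) E (fun p : G × G => p.1 * p.2) univ
  smooth_inv : ManSmoothOn 𝕜 E E (fun g : G => g⁻¹) univ

/-! ### Locally smooth cochains -/

section Cochains

variable (𝕜 : Type w) [RCLike 𝕜]
  (EG : Type w₁) [AddCommGroup EG] [Module 𝕜 EG] [TopologicalSpace EG]
  (EN : Type w₂) [AddCommGroup EN] [Module 𝕜 EN] [TopologicalSpace EN]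
  {G : Type u} [Group G] [TopologicalSpace G] [ChartedSpace EG G]
  {N : Type v} [Group N] [TopologicalSpace N] [ChartedSpace EN N]

/-- `f` is smooth on an open neighborhood of the identity. -/
def LocallySmooth (f : G → N) : Prop :=
  ∃ U : Set G, IsOpen U ∧ 1 ∈ U ∧ ManSmoothOn 𝕜 EG EN f U

/-- `C^1_s(G,N)`: locally smooth normalized maps `G → N`. -/
def IsC1s (h : G → N) : Prop :=
  LocallySmooth 𝕜 EG EN h ∧ h 1 = 1

/-- `C^2_s(G,N)`: locally smooth normalized maps `G × G → N`. -/
def IsC2s (ω : G → G → N) : Prop :=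
  LocallySmooth 𝕜 (EG × EG) EN (fun p : G × G => ω p.1 p.2) ∧ ∀ g, ω g 1 = 1 ∧ ω 1 g = 1

/-- `C^2_ss(G,N)`: those `ω ∈ C^2_s(G,N)` for which every map
`ω_g (x) = ω(g,x) ω(g x g⁻¹, g)⁻¹` is smooth on an identity neighborhood. -/
def IsC2ss (ω : G → G → N) : Prop :=
  IsC2s 𝕜 EG EN ω ∧
    ∀ g : G, LocallySmooth 𝕜 EG EN (fun x : G => ω g x * (ω (g * x * g⁻¹) g)⁻¹)

/-- `φ` is an automorphism of the Lie group `N`. -/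
def IsLieAut (φ : MulAut N) : Prop :=
  ManSmoothOn 𝕜 EN EN (φ : N → N) univ ∧ ManSmoothOn 𝕜 EN EN (φ.symm : N → N) univ

/-- `C^1_s(G, Aut N)`: maps `S` from `G` to the Lie group automorphisms of `N` with `S 1 = id`
for which `(g, n) ↦ S g n` is smooth on `U × N` for some open identity neighborhood `U`. -/
def IsC1sAut (S : G → MulAut N) : Prop :=
  (∀ g, IsLieAut 𝕜 EN (S g)) ∧ S 1 = 1 ∧
    ∃ U : Set G, IsOpen U ∧ 1 ∈ U ∧
      ManSmoothOn 𝕜 (EG × EN) EN (fun p : G × N => S p.1 p.2) (U ×ˢ univ)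

end Cochains

/-- `h.S = (C_N ∘ h) · S`. -/
def actS {G : Type u} {N : Type v} [Group N] (h : G → N) (S : G → MulAut N) : G → MulAut N :=
  fun g => MulAut.conj (h g) * S g

/-- `(h *_S ω)(g,g') = h(g) S(g)(h(g')) ω(g,g') h(gg')⁻¹`. -/
def actOmega {G : Type u} [Group G] {N : Type v} [Group N] (h : G → N) (S : G → MulAut N)
    (ω : G → G → N) : G → G → N :=
  fun g g' => h g * S g (h g') * ω g g' * (h (g * g'))⁻¹

/-- Smooth factor systems: the elements `(S, ω)` of `Z^2_ss(G,N)`, where `δ_S = C_N ∘ ω` and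
`d_S ω = 1`. -/
@[ext]
structure SmoothFactorSystem (𝕜 : Type w) [RCLike 𝕜]
    (EG : Type w₁) [AddCommGroup EG] [Module 𝕜 EG] [TopologicalSpace EG]
    (EN : Type w₂) [AddCommGroup EN] [Module 𝕜 EN] [TopologicalSpace EN]
    (G : Type u) [Group G] [TopologicalSpace G] [ChartedSpace EG G]
    (N : Type v) [Group N] [TopologicalSpace N] [ChartedSpace EN N] where
  S : G → MulAut N
  ω : G → G → N
  isC1sAut : IsC1sAut 𝕜 EG EN S
  isC2ss : IsC2ss 𝕜 EG EN ω
  delta_eq : ∀ g g' : G, S g * S g' * (S (g * g'))⁻¹ = MulAut.conj (ω g g')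
  d_eq_one : ∀ g g' g'' : G,
    S g (ω g' g'') * ω g (g' * g'') * (ω (g * g') g'')⁻¹ * (ω g g')⁻¹ = 1

/-! ### Extensions of Lie groups -/

section Extensions

variable (𝕜 : Type w) [RCLike 𝕜]
  (EG : Type w₁) [AddCommGroup EG] [Module 𝕜 EG] [TopologicalSpace EG]
  (EN : Type w₂) [AddCommGroup EN] [Module 𝕜 EN] [TopologicalSpace EN]

/-- `1 → N → Ĝ → G → 1` is an extension of Lie groups: a short exact sequence of morphisms of Lie
groups that makes `Ĝ` a smooth principal bundle over `G` for the right action `x.n = x ι(n)`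
of `N`. Its local trivializations `(x, n) ↦ σ(x) ι(n)` are given by smooth local sections `σ`. -/
structure IsLieGroupExtension (E : Type w₃) [AddCommGroup E] [Module 𝕜 E] [TopologicalSpace E]
    {G : Type u} [Group G] [TopologicalSpace G] [ChartedSpace EG G]
    {N : Type v} [Group N] [TopologicalSpace N] [ChartedSpace EN N]
    {Ghat : Type*} [Group Ghat] [TopologicalSpace Ghat] [ChartedSpace E Ghat]
    (ι : N →* Ghat) (q : Ghat →* G) : Prop where
  isLieGroup : IsMBLieGroup 𝕜 E Ghat
  smooth_incl : ManSmoothOn 𝕜 EN E ι univ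
  smooth_proj : ManSmoothOn 𝕜 E EG q univ
  injective : Function.Injective ι
  surjective : Function.Surjective q
  exact : ι.range = q.ker
  locallyTrivial : ∀ g : G, ∃ U : Set G, IsOpen U ∧ g ∈ U ∧ ∃ σ : G → Ghat,
    ManSmoothOn 𝕜 EG E σ U ∧ (∀ x ∈ U, q (σ x) = x) ∧
    IsDiffeoOn 𝕜 (EG × EN) E (fun p : G × N => σ p.1 * ι p.2) (U ×ˢ univ) (q ⁻¹' U)

/-- `φ` is an equivalence of extensions: a morphism of Lie groups that induces the identity
on `N` and on `G`. -/
structure IsExtEquivalence (E₁ : Type*) [AddCommGroup E₁] [Module 𝕜 E₁] [TopologicalSpace E₁]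
    (E₂ : Type*) [AddCommGroup E₂] [Module 𝕜 E₂] [TopologicalSpace E₂]
    {G : Type u} [Group G] {N : Type v} [Group N]
    {G₁ : Type*} [Group G₁] [TopologicalSpace G₁] [ChartedSpace E₁ G₁]
    {G₂ : Type*} [Group G₂] [TopologicalSpace G₂] [ChartedSpace E₂ G₂]
    (ι₁ : N →* G₁) (q₁ : G₁ →* G) (ι₂ : N →* G₂) (q₂ : G₂ →* G) (φ : G₁ →* G₂) : Prop where
  smooth : ManSmoothOn 𝕜 E₁ E₂ φ univ
  comp_incl : ∀ n, φ (ι₁ n) = ι₂ n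
  proj_comp : ∀ x, q₂ (φ x) = q₁ x

/-- Lie group extensions of `G` by `N`, with the Lie group in the middle modeled on some
locally convex Hausdorff space. -/
structure LieExtension
    (G : Type u) [Group G] [TopologicalSpace G] [ChartedSpace EG G]
    (N : Type v) [Group N] [TopologicalSpace N] [ChartedSpace EN N] where
  Model : Type (max w₁ w₂)
  [addCommGroup : AddCommGroup Model]
  [module : Module 𝕜 Model]
  [topModel : TopologicalSpace Model]
  [polynormable : PolynormableSpace 𝕜 Model]
  [t2 : T2Space Model]
  Carrier : Type (max u v)
  [group : Group Carrier]
  [topCarrier : TopologicalSpace Carrier]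
  [charted : ChartedSpace Model Carrier]
  incl : N →* Carrier
  proj : Carrier →* G
  isExtension : IsLieGroupExtension 𝕜 EG EN Model incl proj

attribute [instance] LieExtension.addCommGroup LieExtension.module LieExtension.topModel
  LieExtension.polynormable LieExtension.t2 LieExtension.group LieExtension.topCarrier
  LieExtension.charted

variable {𝕜 EG EN} in
/-- Two extensions are equivalent if there is an equivalence from the first to the second. -/
def LieExtension.Equivalent
    {G : Type u} [Group G] [TopologicalSpace G] [ChartedSpace EG G]
    {N : Type v} [Group N] [TopologicalSpace N] [ChartedSpace EN N]
    (X Y : LieExtension 𝕜 EG EN G N) : Prop :=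
  ∃ φ : X.Carrier →* Y.Carrier,
    IsExtEquivalence 𝕜 X.Model Y.Model X.incl X.proj Y.incl Y.proj φ

/-- `Ext(G,N)`: the set of equivalence classes of Lie group extensions of `G` by `N`. -/
def LieExt
    (G : Type u) [Group G] [TopologicalSpace G] [ChartedSpace EG G]
    (N : Type v) [Group N] [TopologicalSpace N] [ChartedSpace EN N] :=
  Quot (LieExtension.Equivalent (𝕜 := 𝕜) (EG := EG) (EN := EN) (G := G) (N := N))

end Extensions

/-! ### The extension defined by a smooth factor system -/

section TwistedProduct

variable {𝕜 : Type w} [RCLike 𝕜]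
  {EG : Type w₁} [AddCommGroup EG] [Module 𝕜 EG] [TopologicalSpace EG]
  {EN : Type w₂} [AddCommGroup EN] [Module 𝕜 EN] [TopologicalSpace EN]
  {G : Type u} [Group G] [TopologicalSpace G] [ChartedSpace EG G]
  {N : Type v} [Group N] [TopologicalSpace N] [ChartedSpace EN N]

/-- The set `N × G`, underlying the group `N ×_(S,ω) G`. -/
@[ext]
structure TwistedProduct (f : SmoothFactorSystem 𝕜 EG EN G N) where
  fst : N
  snd : G

namespace TwistedProduct

variable {f : SmoothFactorSystem 𝕜 EG EN G N}

/-- `(n,g)(n',g') = (n S(g)(n') ω(g,g'), gg')`. -/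
instance : Mul (TwistedProduct f) :=
  ⟨fun x y => ⟨x.fst * f.S x.snd y.fst * f.ω x.snd y.snd, x.snd * y.snd⟩⟩

instance : One (TwistedProduct f) := ⟨⟨1, 1⟩⟩

instance : Inv (TwistedProduct f) :=
  ⟨fun x => ⟨(f.ω x.snd⁻¹ x.snd)⁻¹ * f.S x.snd⁻¹ x.fst⁻¹, x.snd⁻¹⟩⟩

theorem mul_def (x y : TwistedProduct f) :
    x * y = ⟨x.fst * f.S x.snd y.fst * f.ω x.snd y.snd, x.snd * y.snd⟩ := rfl

theorem one_def : (1 : TwistedProduct f) = ⟨1, 1⟩ := rfl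

theorem inv_def (x : TwistedProduct f) :
    x⁻¹ = ⟨(f.ω x.snd⁻¹ x.snd)⁻¹ * f.S x.snd⁻¹ x.fst⁻¹, x.snd⁻¹⟩ := rfl

theorem S_S (f : SmoothFactorSystem 𝕜 EG EN G N) (g g' : G) (n : N) :
    f.S g (f.S g' n) = f.ω g g' * f.S (g * g') n * (f.ω g g')⁻¹ := by
  have h := f.delta_eq g g'
  rw [mul_inv_eq_iff_eq_mul] at h
  simpa using congrArg (fun φ : MulAut N => φ n) h

theorem S_omega (f : SmoothFactorSystem 𝕜 EG EN G N) (g g' g'' : G) :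
    f.S g (f.ω g' g'') * f.ω g (g' * g'') = f.ω g g' * f.ω (g * g') g'' := by
  have h := f.d_eq_one g g' g''
  rwa [mul_inv_eq_one, mul_inv_eq_iff_eq_mul] at h

instance : Group (TwistedProduct f) :=
  Group.ofLeftAxioms
    (by
      intro x y z
      ext
      · simp only [mul_def, map_mul, S_S, mul_assoc, S_omega, inv_mul_cancel_left]
      · simp only [mul_def, mul_assoc])
    (by
      intro x
      ext
      · simp [mul_def, one_def, f.isC1sAut.2.1, (f.isC2ss.1.2 x.snd).2]
      · simp [mul_def, one_def])
    (by
      intro x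
      ext
      · simp [mul_def, one_def, inv_def]
      · simp [mul_def, one_def, inv_def])

/-- The inclusion `n ↦ (n, 1)`. -/
def inclHom (f : SmoothFactorSystem 𝕜 EG EN G N) : N →* TwistedProduct f where
  toFun n := ⟨n, 1⟩
  map_one' := rfl
  map_mul' n n' := by
    ext
    · simp [mul_def, f.isC1sAut.2.1, (f.isC2ss.1.2 1).1]
    · simp [mul_def]

/-- The projection `(n, g) ↦ g`. -/
def projHom (f : SmoothFactorSystem 𝕜 EG EN G N) : TwistedProduct f →* G where
  toFun x := x.snd
  map_one' := rfl
  map_mul' _ _ := rfl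

end TwistedProduct

/-- The Lie group structure on `N ×_(S,ω) G`: for some open identity neighborhood `U` of `G`, the
map `(n, g) ↦ (n, g)` restricts to a diffeomorphism of the open set `N × U` of the product manifold
`N × G` onto an open subset of `N ×_(S,ω) G`. -/
structure TwistedLieStructure (f : SmoothFactorSystem 𝕜 EG EN G N) where
  Model : Type (max w₁ w₂)
  [addCommGroup : AddCommGroup Model]
  [module : Module 𝕜 Model]
  [topModel : TopologicalSpace Model]
  [polynormable : PolynormableSpace 𝕜 Model]
  [t2 : T2Space Model]
  [top : TopologicalSpace (TwistedProduct f)]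
  [charted : ChartedSpace Model (TwistedProduct f)]
  isLieGroup : IsMBLieGroup 𝕜 Model (TwistedProduct f)
  isDiffeoOn : ∃ U : Set G, IsOpen U ∧ 1 ∈ U ∧
    IsDiffeoOn 𝕜 (EN × EG) Model (fun p : N × G => (⟨p.1, p.2⟩ : TwistedProduct f))
      (univ ×ˢ U) {x | x.snd ∈ U}

namespace TwistedLieStructure

variable {f : SmoothFactorSystem 𝕜 EG EN G N}

attribute [instance] addCommGroup module topModel polynormable t2

/-- The group `N ×_(S,ω) G` endowed with the topology and the charts of `L`. -/
def Carrier (_L : TwistedLieStructure f) := TwistedProduct f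

instance (L : TwistedLieStructure f) : Group L.Carrier :=
  inferInstanceAs (Group (TwistedProduct f))

instance (L : TwistedLieStructure f) : TopologicalSpace L.Carrier := L.top

instance (L : TwistedLieStructure f) : ChartedSpace L.Model L.Carrier := L.charted

/-- The element `(n, g)` of `N ×_(S,ω) G`. -/
def mk' (L : TwistedLieStructure f) (n : N) (g : G) : L.Carrier := TwistedProduct.mk n g

/-- The inclusion `n ↦ (n, 1)`. -/
def incl (L : TwistedLieStructure f) : N →* L.Carrier := TwistedProduct.inclHom f

/-- The projection `(n, g) ↦ g`. -/
def proj (L : TwistedLieStructure f) : L.Carrier →* G := TwistedProduct.projHom f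

/-- `N → N ×_(S,ω) G → G` is an extension of Lie groups. -/
def IsExtension (L : TwistedLieStructure f) : Prop :=
  IsLieGroupExtension 𝕜 EG EN L.Model L.incl L.proj

/-- `N ×_(S,ω) G` as an extension of `G` by `N`. -/
def toLieExtension (L : TwistedLieStructure f) (hL : L.IsExtension) :
    LieExtension 𝕜 EG EN G N where
  Model := L.Model
  Carrier := L.Carrier
  incl := L.incl
  proj := L.proj
  isExtension := hL

/-- `φ : N ×_f' G → N ×_f G` is an equivalence of extensions of `G` by `N`. -/
def IsEquivalence {f' f : SmoothFactorSystem 𝕜 EG EN G N} (L' : TwistedLieStructure f')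
    (L : TwistedLieStructure f) (φ : L'.Carrier →* L.Carrier) : Prop :=
  IsExtEquivalence 𝕜 L'.Model L.Model L'.incl L'.proj L.incl L.proj φ

end TwistedLieStructure

end TwistedProduct

-- A section `σ` of an extension with `σ 1 = 1`, smooth near `1`, encodes the extension: `S g` is
-- conjugation by `σ g` on `N`, and `ω g g'` is the defect `σ g σ g' (σ (g g'))⁻¹`. The map `(n, g)
-- ↦ ι(n) σ(g)` then identifies the extension with a twisted product (`exists_factorSystem`), which
-- gives surjectivity onto the classes of extensions. An equivalence between twisted products is the
-- identity on `N` and on `G`, hence of the form `(n, g) ↦ (n h(g), g)`. Its compatibility with the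
-- products `(1, g)(n, 1)` and `(1, g)(1, g')` amounts to the formulas for `h.S` and `h *_S ω`
-- (`exists_of_isEquivalence`, `exists_isEquivalence`), so orbits correspond to classes.
--
-- The analysis rests on three facts. The chain rule in locally convex spaces follows from a mean
-- value inequality, obtained by testing with functionals from Hahn-Banach. A group becomes a Lie
-- group once the translates of local charts are compatible and multiplication, inversion and every
-- conjugation are smooth at `1` (`LocalLieData`). For the twisted product, conjugation by an
-- element over `g` involves `ω(g, x) ω(g x g⁻¹, g)⁻¹`, and the condition defining `C^2_ss` makes
-- exactly this expression smooth near `x = 1`. Finally, a homomorphism smooth near `1` is smooth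
-- everywhere. This reduces all smoothness questions about equivalences to a neighborhood of `1` and
-- makes the Lie group structure on the twisted product unique.

universe w₄ u' v'

/-! ### Calculus in locally convex spaces -/

section Calculus

variable {𝕜 : Type w} [RCLike 𝕜]

/-- Hahn-Banach: a functional that is dominated by a continuous seminorm and attains it at a
given vector. -/
theorem exists_strongDual_le_seminorm {Y : Type w₂} [AddCommGroup Y] [Module 𝕜 Y]
    [TopologicalSpace Y] [PolynormableSpace 𝕜 Y] {p : Seminorm 𝕜 Y} (hp : Continuous p) (v : Y)
    (hv : p v ≠ 0) :
    ∃ φ : Y →L[𝕜] 𝕜, φ v = (p v : 𝕜) ∧ ∀ y, ‖φ y‖ ≤ p y := by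
  have hv0 : v ≠ 0 := by
    rintro rfl
    simp at hv
  -- The functional to extend is `c • v ↦ c * p v` on the line through `v`; its norm at `c • v`
  -- equals `p (c • v)`.
  obtain ⟨g, hg, hle⟩ := Module.Dual.exists_continuous_extension_of_le_seminorm
    (Submodule.span 𝕜 {v})
    ((p v : 𝕜) • (LinearEquiv.coord 𝕜 Y v hv0 : Submodule.span 𝕜 {v} →ₗ[𝕜] 𝕜)) hp (by
      intro x
      obtain ⟨c, hc⟩ := Submodule.mem_span_singleton.1 x.2
      have hx : x = c • (⟨v, Submodule.mem_span_singleton_self v⟩ : Submodule.span 𝕜 {v}) :=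
        Subtype.ext hc.symm
      have h1 : LinearEquiv.coord 𝕜 Y v hv0 x = c := by
        rw [hx, map_smul, LinearEquiv.coord_self, smul_eq_mul, mul_one]
      rw [← hc, map_smul_eq_mul, LinearMap.smul_apply, LinearEquiv.coe_coe, h1, smul_eq_mul,
        norm_mul, mul_comm, RCLike.norm_ofReal, abs_of_nonneg (apply_nonneg p v)])
  refine ⟨g, ?_, hle⟩
  have := hg ⟨v, Submodule.mem_span_singleton_self v⟩
  rw [this, LinearMap.smul_apply, LinearEquiv.coe_coe, LinearEquiv.coord_self, smul_eq_mul, mul_one]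

section

variable {X : Type w₁} [AddCommGroup X] [Module 𝕜 X]
  {Y : Type w₂} [AddCommGroup Y] [Module 𝕜 Y] [TopologicalSpace Y] [PolynormableSpace 𝕜 Y]

/-- Mean value inequality along a segment. -/
theorem seminorm_slope_sub_le {f : X → Y} {df : X × X → Y} {x h : X} {t : 𝕜} (ht : t ≠ 0) {y : Y}
    {ε : ℝ} {p : Seminorm 𝕜 Y} (hp : Continuous p)
    (hd : ∀ s ∈ Icc (0 : ℝ) 1, Tendsto
      (fun r : 𝕜 => r⁻¹ • (f (x + (s * t : 𝕜) • h + r • h) - f (x + (s * t : 𝕜) • h))) (𝓝[≠] 0)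
      (𝓝 (df (x + (s * t : 𝕜) • h, h))))
    (hε : ∀ s ∈ Icc (0 : ℝ) 1, p (df (x + (s * t : 𝕜) • h, h) - y) < ε) :
    p (t⁻¹ • (f (x + t • h) - f x) - y) < ε := by
  set v := t⁻¹ • (f (x + t • h) - f x) - y with hv
  have hε0 : 0 < ε := (apply_nonneg p _).trans_lt (hε 0 (by simp))
  by_cases hpv : p v = 0
  · rwa [hpv]
  obtain ⟨φ, hφv, hφ⟩ := exists_strongDual_le_seminorm hp v hpv
  -- A real function to which the classical mean value theorem applies, over either field: `F 1 - F
  -- 0 = re (φ v) = p v`, while `F' s` is the real part of `φ (df (x + s t h, h) - y)`, bounded by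
  -- the seminorm in `hε`.
  let F : ℝ → ℝ := fun s => RCLike.re (φ (t⁻¹ • f (x + (s * t : 𝕜) • h))) - s * RCLike.re (φ y)
  have hF : ∀ s ∈ Icc (0 : ℝ) 1,
      HasDerivAt F (RCLike.re (φ (df (x + (s * t : 𝕜) • h, h) - y))) s := by
    intro s hs
    have h1 : Tendsto (fun r : ℝ => (r * t : 𝕜)) (𝓝[≠] 0) (𝓝[≠] 0) := by
      refine tendsto_nhdsWithin_iff.2 ⟨?_, ?_⟩
      · have : Continuous fun r : ℝ => (r * t : 𝕜) := by fun_prop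
        exact (this.tendsto' 0 0 (by simp)).mono_left nhdsWithin_le_nhds
      · filter_upwards [self_mem_nhdsWithin] with r hr
        simpa [ht] using hr
    have h2 := (hd s hs).comp h1
    have h3 : HasDerivAt (fun s : ℝ => RCLike.re (φ (t⁻¹ • f (x + (s * t : 𝕜) • h))))
        (RCLike.re (φ (df (x + (s * t : 𝕜) • h, h)))) s := by
      rw [hasDerivAt_iff_tendsto_slope_zero]
      have h4 : Continuous fun y : Y => RCLike.re (φ y) := RCLike.continuous_re.comp φ.continuous
      refine ((h4.tendsto _).comp h2).congr fun r => ?_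
      simp only [Function.comp_apply, map_smul, map_sub, smul_eq_mul, mul_inv, mul_assoc]
      rw [← RCLike.ofReal_inv, RCLike.re_ofReal_mul, mul_sub, map_sub]
      congr 5
      rw [RCLike.ofReal_add, add_mul, add_smul, add_assoc]
    have h4 := h3.sub ((hasDerivAt_id s).mul_const (RCLike.re (φ y)))
    rw [one_mul] at h4
    rw [map_sub, map_sub]
    exact h4
  obtain ⟨s, hs, hs'⟩ := exists_hasDerivAt_eq_slope F _ zero_lt_one
    (fun s hs => (hF s hs).continuousAt.continuousWithinAt) (fun s hs => hF s ⟨hs.1.le, hs.2.le⟩)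
  have h5 : F 1 - F 0 = p v := by
    have : RCLike.re (φ v) = p v := by rw [hφv, RCLike.ofReal_re]
    rw [← this, hv]
    simp only [F, map_smul, map_sub, smul_sub, RCLike.ofReal_one, RCLike.ofReal_zero, one_mul,
      zero_mul, zero_smul, add_zero]
    ring
  rw [sub_zero, div_one, h5] at hs'
  rw [← hs']
  exact (RCLike.re_le_norm _).trans_lt ((hφ _).trans_lt (hε s ⟨hs.1.le, hs.2.le⟩))

/-- The difference quotients of a `C^1`-map converge locally uniformly in the direction. -/
theorem tendsto_slope_prod [TopologicalSpace X] [PolynormableSpace 𝕜 X] {f : X → Y}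
    {df : X × X → Y} {U : Set X} (hU : IsOpen U)
    (hd : ∀ x ∈ U, ∀ h : X,
      Tendsto (fun t : 𝕜 => t⁻¹ • (f (x + t • h) - f x)) (𝓝[≠] 0) (𝓝 (df (x, h))))
    (hdf : ContinuousOn df (U ×ˢ univ)) {x : X} (hx : x ∈ U) (h : X) :
    Tendsto (fun q : X × 𝕜 => q.2⁻¹ • (f (x + q.2 • q.1) - f x)) (𝓝 h ×ˢ 𝓝[≠] 0)
      (𝓝 (df (x, h))) := by
  have := (PolynormableSpace.withSeminorms 𝕜 X).topologicalAddGroup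
  have := (PolynormableSpace.withSeminorms 𝕜 X).continuousSMul
  have := (PolynormableSpace.withSeminorms 𝕜 Y).topologicalAddGroup
  rw [(PolynormableSpace.withSeminorms 𝕜 Y).tendsto_nhds]
  rintro ⟨p, hp⟩ ε hε
  have h1 : ContinuousAt df (x, h) :=
    hdf.continuousAt ((hU.prod isOpen_univ).mem_nhds ⟨hx, mem_univ _⟩)
  have h2 : ∀ᶠ z in 𝓝 (x, h), p (df z - df (x, h)) < ε := by
    have : ContinuousAt (fun z => p (df z - df (x, h))) (x, h) :=
      hp.continuousAt.comp (h1.sub continuousAt_const)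
    exact this.eventually_lt continuousAt_const (by simpa using hε)
  have h3 : ∀ᶠ q : X × 𝕜 in 𝓝 (h, 0),
      x + q.2 • q.1 ∈ U ∧ p (df (x + q.2 • q.1, q.1) - df (x, h)) < ε := by
    have h4 : Continuous fun q : X × 𝕜 => (x + q.2 • q.1, q.1) := by fun_prop
    have h5 : ∀ᶠ z : X × X in 𝓝 (x, h), z.1 ∈ U ∧ p (df z - df (x, h)) < ε :=
      ((hU.preimage continuous_fst).eventually_mem hx).and h2
    exact (h4.tendsto' (h, 0) (x, h) (by simp)).eventually h5
  rw [nhds_prod_eq] at h3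
  obtain ⟨pa, ha, pb, hb, hab⟩ := eventually_prod_iff.1 h3
  -- A ball around `0` contains `s * t` for every `s ∈ [0, 1]` along with `t`, so the estimate holds
  -- on the whole segment used by the mean value inequality.
  obtain ⟨δ, hδ, hball⟩ := Metric.eventually_nhds_iff.1 hb
  refine eventually_prod_iff.2 ⟨pa, ha, fun t => t ≠ 0 ∧ dist t 0 < δ, ?_, ?_⟩
  · exact (eventually_mem_nhdsWithin).and
      ((Metric.eventually_nhds_iff.2 ⟨δ, hδ, fun _ h => h⟩).filter_mono nhdsWithin_le_nhds)
  · rintro k hk t ⟨ht, htδ⟩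
    have key : ∀ s ∈ Icc (0 : ℝ) 1, pb (s * t : 𝕜) := by
      intro s hs
      apply hball
      rw [dist_zero_right] at htδ ⊢
      rw [norm_mul, RCLike.norm_ofReal, abs_of_nonneg hs.1]
      exact (mul_le_of_le_one_left (norm_nonneg _) hs.2).trans_lt htδ
    exact seminorm_slope_sub_le ht hp (fun s hs => hd _ (hab hk (key s hs)).1 k)
      fun s hs => (hab hk (key s hs)).2

end

/-! ### Permanence properties of `C^n`-maps and the chain rule -/

theorem MBContDiffOn.continuousOn {Y : Type w₂} [AddCommGroup Y] [Module 𝕜 Y]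
    [TopologicalSpace Y] {n : ℕ} {X : Type w₁} [AddCommGroup X] [Module 𝕜 X] [TopologicalSpace X]
    {f : X → Y} {U : Set X} (h : MBContDiffOn 𝕜 n f U) : ContinuousOn f U := by
  cases n with
  | zero => exact h
  | succ n => exact h.1

theorem MBContDiffOn.mono {Y : Type w₂} [AddCommGroup Y] [Module 𝕜 Y]
    [TopologicalSpace Y] {n : ℕ} {X : Type w₁} [AddCommGroup X] [Module 𝕜 X] [TopologicalSpace X]
    {f : X → Y} {U V : Set X} (h : MBContDiffOn 𝕜 n f U) (hV : V ⊆ U) : MBContDiffOn 𝕜 n f V := by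
  induction n generalizing X with
  | zero => exact ContinuousOn.mono h hV
  | succ n ih =>
    obtain ⟨hc, df, hd, hdf⟩ := h
    exact ⟨hc.mono hV, df, fun x hx => hd x (hV hx), ih hdf (prod_mono_left hV)⟩

theorem MBContDiffOn.of_succ {Y : Type w₂} [AddCommGroup Y] [Module 𝕜 Y]
    [TopologicalSpace Y] {n : ℕ} {X : Type w₁} [AddCommGroup X] [Module 𝕜 X] [TopologicalSpace X]
    {f : X → Y} {U : Set X} (h : MBContDiffOn 𝕜 (n + 1) f U) : MBContDiffOn 𝕜 n f U := by
  induction n generalizing X with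
  | zero => exact h.1
  | succ n ih =>
    obtain ⟨hc, df, hd, hdf⟩ := h
    exact ⟨hc, df, hd, ih hdf⟩

theorem eventually_add_smul_mem {X : Type w₁} [AddCommGroup X] [Module 𝕜 X] [TopologicalSpace X]
    [PolynormableSpace 𝕜 X] {U : Set X} (hU : IsOpen U) {x : X} (hx : x ∈ U) (h : X) :
    ∀ᶠ t : 𝕜 in 𝓝[≠] 0, x + t • h ∈ U := by
  have := (PolynormableSpace.withSeminorms 𝕜 X).topologicalAddGroup
  have := (PolynormableSpace.withSeminorms 𝕜 X).continuousSMul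
  have h1 : Continuous fun t : 𝕜 => x + t • h := by fun_prop
  exact ((h1.tendsto' 0 x (by simp)).eventually (hU.eventually_mem hx)).filter_mono
    nhdsWithin_le_nhds

/-- Difference quotients at `x` use values at nearby points, which lie in `U` for small `t` because
`U` is open; hence the same `df` serves for both maps. -/
theorem MBContDiffOn.congr {Y : Type w₂} [AddCommGroup Y] [Module 𝕜 Y]
    [TopologicalSpace Y] {n : ℕ} {X : Type w₁} [AddCommGroup X] [Module 𝕜 X] [TopologicalSpace X]
    [PolynormableSpace 𝕜 X] {f g : X → Y} {U : Set X} (h : MBContDiffOn 𝕜 n f U) (hU : IsOpen U)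
    (hg : EqOn g f U) : MBContDiffOn 𝕜 n g U := by
  cases n with
  | zero => exact ContinuousOn.congr h hg
  | succ n =>
    obtain ⟨hc, df, hd, hdf⟩ := h
    refine ⟨hc.congr hg, df, fun x hx k => (hd x hx k).congr' ?_, hdf⟩
    filter_upwards [eventually_add_smul_mem hU hx k] with t ht
    rw [hg hx, hg ht]

/-- Being of class `C^n` is a local property. -/
theorem MBContDiffOn.of_locally {Y : Type w₂} [AddCommGroup Y] [Module 𝕜 Y]
    [TopologicalSpace Y] [T2Space Y] {n : ℕ} {X : Type w₁} [AddCommGroup X] [Module 𝕜 X]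
    [TopologicalSpace X] [PolynormableSpace 𝕜 X] {f : X → Y} {U : Set X}
    (h : ∀ x ∈ U, ∃ V, IsOpen V ∧ x ∈ V ∧ MBContDiffOn 𝕜 n f V) : MBContDiffOn 𝕜 n f U := by
  have hc : ContinuousOn f U := fun x hx => by
    obtain ⟨V, hV, hxV, hfV⟩ := h x hx
    exact (hfV.continuousOn.continuousAt (hV.mem_nhds hxV)).continuousWithinAt
  induction n generalizing X with
  | zero => exact hc
  | succ n ih =>
    have h1 : ∀ z : X × X, ∃ y : Y, z.1 ∈ U →
        Tendsto (fun t : 𝕜 => t⁻¹ • (f (z.1 + t • z.2) - f z.1)) (𝓝[≠] 0) (𝓝 y) := by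
      intro z
      by_cases hz : z.1 ∈ U
      · obtain ⟨V, hV, hxV, -, df, hd, -⟩ := h z.1 hz
        exact ⟨df z, fun _ => hd z.1 hxV z.2⟩
      · exact ⟨0, fun hz' => absurd hz' hz⟩
    choose df hdf using h1
    -- The derivatives on the sets `V` are unrelated functions. Taking the limit itself as
    -- derivative gives one global function, which agrees with each of them where they are defined
    -- because limits in `Y` are unique.
    refine ⟨hc, fun z => limUnder (𝓝[≠] (0 : 𝕜))
      (fun t : 𝕜 => t⁻¹ • (f (z.1 + t • z.2) - f z.1)), fun x hx k => ?_, ?_⟩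
    · exact tendsto_nhds_limUnder ⟨_, hdf (x, k) hx⟩
    have h2 : ∀ z ∈ U ×ˢ (univ : Set X), ∃ V, IsOpen V ∧ z ∈ V ∧
        MBContDiffOn 𝕜 n (fun z => limUnder (𝓝[≠] (0 : 𝕜))
          (fun t : 𝕜 => t⁻¹ • (f (z.1 + t • z.2) - f z.1))) V := by
      intro z hz
      obtain ⟨V, hV, hxV, -, df', hd', hdf'⟩ := h z.1 hz.1
      refine ⟨V ×ˢ univ, hV.prod isOpen_univ, ⟨hxV, mem_univ _⟩,
        hdf'.congr (hV.prod isOpen_univ) fun y hy => ?_⟩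
      exact (hd' y.1 hy.1 y.2).limUnder_eq
    refine ih h2 fun z hz => ?_
    obtain ⟨V, hV, hxV, hfV⟩ := h2 z hz
    exact (hfV.continuousOn.continuousAt (hV.mem_nhds hxV)).continuousWithinAt

theorem MBContDiffOn.const {Y : Type w₂} [AddCommGroup Y] [Module 𝕜 Y]
    [TopologicalSpace Y] {n : ℕ} {X : Type w₁} [AddCommGroup X] [Module 𝕜 X]
    [TopologicalSpace X] (y : Y) (U : Set X) : MBContDiffOn 𝕜 n (fun _ : X => y) U := by
  induction n generalizing X y with
  | zero => exact continuousOn_const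
  | succ n ih =>
    exact ⟨continuousOn_const, fun _ => 0, fun _ _ _ => by simp [tendsto_const_nhds], ih _ _⟩

theorem MBContDiffOn.prodMk {Y : Type w₂} [AddCommGroup Y] [Module 𝕜 Y]
    [TopologicalSpace Y] {Z : Type w₃} [AddCommGroup Z] [Module 𝕜 Z] [TopologicalSpace Z]
    {n : ℕ} {X : Type w₁} [AddCommGroup X] [Module 𝕜 X]
    [TopologicalSpace X] {f : X → Y} {g : X → Z} {U : Set X} (hf : MBContDiffOn 𝕜 n f U)
    (hg : MBContDiffOn 𝕜 n g U) : MBContDiffOn 𝕜 n (fun x => (f x, g x)) U := by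
  induction n generalizing X with
  | zero => exact ContinuousOn.prodMk hf hg
  | succ n ih =>
    obtain ⟨hc, df, hd, hdf⟩ := hf
    obtain ⟨hc', dg, hd', hdg⟩ := hg
    exact ⟨hc.prodMk hc', fun z => (df z, dg z),
      fun x hx h => (hd x hx h).prodMk_nhds (hd' x hx h), ih hdf hdg⟩

/-- The difference quotient of `f ∘ L` at `x` along `h` is that of `f` at `L x` along `L h`, so this
case precedes the chain rule, whose proof uses it for a projection. -/
theorem MBContDiffOn.comp_clm {Y : Type w₂} [AddCommGroup Y] [Module 𝕜 Y]
    [TopologicalSpace Y] {n : ℕ} {X : Type w₁} [AddCommGroup X] [Module 𝕜 X]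
    [TopologicalSpace X] {X' : Type w₃} [AddCommGroup X'] [Module 𝕜 X']
    [TopologicalSpace X'] {f : X → Y} {U : Set X} (hf : MBContDiffOn 𝕜 n f U) (L : X' →L[𝕜] X)
    {V : Set X'} (hV : MapsTo L V U) : MBContDiffOn 𝕜 n (fun x => f (L x)) V := by
  induction n generalizing X X' with
  | zero => exact ContinuousOn.comp hf L.continuous.continuousOn hV
  | succ n ih =>
    obtain ⟨hc, df, hd, hdf⟩ := hf
    exact ⟨hc.comp L.continuous.continuousOn hV, fun z => df (L.prodMap L z),
      fun x hx h => by simpa using hd (L x) (hV hx) (L h),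
      ih hdf (L.prodMap L) fun z hz => ⟨hV hz.1, mem_univ _⟩⟩

/-- The chain rule. -/
theorem MBContDiffOn.comp {n : ℕ} {X : Type w₁} [AddCommGroup X] [Module 𝕜 X]
    [TopologicalSpace X] [PolynormableSpace 𝕜 X]
    {Y : Type w₂} [AddCommGroup Y] [Module 𝕜 Y] [TopologicalSpace Y] [PolynormableSpace 𝕜 Y]
    {Z : Type w₃} [AddCommGroup Z] [Module 𝕜 Z] [TopologicalSpace Z] [PolynormableSpace 𝕜 Z]
    {g : Y → Z} {f : X → Y} {U : Set X} {V : Set Y} (hg : MBContDiffOn 𝕜 n g V)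
    (hf : MBContDiffOn 𝕜 n f U) (hV : IsOpen V) (hfUV : MapsTo f U V) :
    MBContDiffOn 𝕜 n (fun x => g (f x)) U := by
  induction n generalizing X Y with
  | zero => exact ContinuousOn.comp hg hf hfUV
  | succ n ih =>
    have hfn := hf.of_succ
    obtain ⟨hc, df, hd, hdf⟩ := hf
    obtain ⟨hc', dg, hd', hdg⟩ := hg
    refine ⟨hc'.comp hc hfUV, fun z => dg (f z.1, df z), fun x hx h => ?_, ?_⟩
    -- The difference quotient of `g ∘ f` is that of `g` at `f x` along the varying direction `t⁻¹ •
    -- (f (x + t • h) - f x)`, which tends to `df (x, h)`; convergence jointly in direction and `t`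
    -- is therefore required.
    · have h1 := tendsto_slope_prod hV hd' hdg.continuousOn (hfUV hx) (df (x, h))
      have h2 : Tendsto (fun t : 𝕜 => (t⁻¹ • (f (x + t • h) - f x), t)) (𝓝[≠] 0)
          (𝓝 (df (x, h)) ×ˢ 𝓝[≠] 0) := (hd x hx h).prodMk tendsto_id
      refine (h1.comp h2).congr' ?_
      filter_upwards [self_mem_nhdsWithin] with t ht
      simp [smul_inv_smul₀ (show t ≠ 0 from ht)]
    -- The derivative is `dg` composed with `z ↦ (f z.1, df z)`, again a composition of `C^n`-maps,
    -- so the induction hypothesis applies on the larger spaces.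
    · have h3 : MBContDiffOn 𝕜 n (fun z : X × X => f z.1) (U ×ˢ univ) :=
        hfn.comp_clm (ContinuousLinearMap.fst 𝕜 X X) fun z hz => hz.1
      exact ih hdg (h3.prodMk hdf) (hV.prod isOpen_univ) fun z hz => ⟨hfUV hz.1, mem_univ _⟩

end Calculus

/-! ### The same properties for smooth maps -/

section Smooth

variable {𝕜 : Type w} [RCLike 𝕜]
  {X : Type w₁} [AddCommGroup X] [Module 𝕜 X] [TopologicalSpace X]
  {Y : Type w₂} [AddCommGroup Y] [Module 𝕜 Y] [TopologicalSpace Y]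
  {Z : Type w₃} [AddCommGroup Z] [Module 𝕜 Z] [TopologicalSpace Z]

theorem MBSmoothOn.continuousOn {f : X → Y} {U : Set X} (h : MBSmoothOn 𝕜 f U) :
    ContinuousOn f U := h 0

theorem MBSmoothOn.mono {f : X → Y} {U V : Set X} (h : MBSmoothOn 𝕜 f U) (hV : V ⊆ U) :
    MBSmoothOn 𝕜 f V := fun n => (h n).mono hV

theorem MBSmoothOn.congr [PolynormableSpace 𝕜 X] {f g : X → Y} {U : Set X}
    (h : MBSmoothOn 𝕜 f U) (hU : IsOpen U) (hg : EqOn g f U) : MBSmoothOn 𝕜 g U :=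
  fun n => (h n).congr hU hg

theorem MBSmoothOn.of_locally [T2Space Y] [PolynormableSpace 𝕜 X] {f : X → Y} {U : Set X}
    (h : ∀ x ∈ U, ∃ V, IsOpen V ∧ x ∈ V ∧ MBSmoothOn 𝕜 f V) : MBSmoothOn 𝕜 f U :=
  fun n => MBContDiffOn.of_locally fun x hx =>
    let ⟨V, hV, hxV, hf⟩ := h x hx
    ⟨V, hV, hxV, hf n⟩

theorem MBSmoothOn.const (y : Y) (U : Set X) : MBSmoothOn 𝕜 (fun _ : X => y) U :=
  fun _ => MBContDiffOn.const y U

theorem MBSmoothOn.prodMk {f : X → Y} {g : X → Z} {U : Set X} (hf : MBSmoothOn 𝕜 f U)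
    (hg : MBSmoothOn 𝕜 g U) : MBSmoothOn 𝕜 (fun x => (f x, g x)) U :=
  fun n => (hf n).prodMk (hg n)

theorem MBSmoothOn.comp_clm {f : Y → Z} {V : Set Y} (hf : MBSmoothOn 𝕜 f V) (L : X →L[𝕜] Y)
    {U : Set X} (hU : MapsTo L U V) : MBSmoothOn 𝕜 (fun x => f (L x)) U :=
  fun n => (hf n).comp_clm L hU

theorem MBSmoothOn.comp [PolynormableSpace 𝕜 X] [PolynormableSpace 𝕜 Y] [PolynormableSpace 𝕜 Z]
    {g : Y → Z} {f : X → Y} {U : Set X} {V : Set Y} (hg : MBSmoothOn 𝕜 g V)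
    (hf : MBSmoothOn 𝕜 f U) (hV : IsOpen V) (hfUV : MapsTo f U V) :
    MBSmoothOn 𝕜 (fun x => g (f x)) U :=
  fun n => (hg n).comp (hf n) hV hfUV

end Smooth

/-! ### Calculus on manifolds -/

section Manifolds

variable {𝕜 : Type w} [RCLike 𝕜]
  {E : Type w₁} [AddCommGroup E] [Module 𝕜 E] [TopologicalSpace E]
  {E' : Type w₂} [AddCommGroup E'] [Module 𝕜 E'] [TopologicalSpace E']
  {E'' : Type w₃} [AddCommGroup E''] [Module 𝕜 E''] [TopologicalSpace E'']
  {M : Type u} [TopologicalSpace M] [ChartedSpace E M]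
  {M' : Type v} [TopologicalSpace M'] [ChartedSpace E' M']
  {M'' : Type u'} [TopologicalSpace M''] [ChartedSpace E'' M'']

/-- Class version of `IsMBManifold`. -/
class MBManifold (𝕜 : Type w) [RCLike 𝕜] (E : Type w₁) [AddCommGroup E] [Module 𝕜 E]
    [TopologicalSpace E] (M : Type u) [TopologicalSpace M] [ChartedSpace E M] : Prop where
  isManifold : IsMBManifold 𝕜 E M

variable (𝕜 E E') in
/-- `f` is smooth on an open neighborhood of `x`. -/
def ManSmoothAt (f : M → M') (x : M) : Prop :=
  ∃ U : Set M, IsOpen U ∧ x ∈ U ∧ ManSmoothOn 𝕜 E E' f U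

theorem ManSmoothOn.mono {f : M → M'} {s t : Set M} (h : ManSmoothOn 𝕜 E E' f s) (ht : t ⊆ s) :
    ManSmoothOn 𝕜 E E' f t :=
  ⟨h.1.mono ht, fun e he e' he' => (h.2 e he e' he').mono
    (inter_subset_inter_right _ (preimage_mono (inter_subset_inter_left _ ht)))⟩

omit [AddCommGroup E] [AddCommGroup E'] [ChartedSpace E M] [ChartedSpace E' M'] in
theorem isOpen_chart_domain {f : M → M'} {s : Set M} (hf : ContinuousOn f s) (hs : IsOpen s)
    (e : OpenPartialHomeomorph M E) (e' : OpenPartialHomeomorph M' E') :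
    IsOpen (e.target ∩ e.symm ⁻¹' (s ∩ f ⁻¹' e'.source)) :=
  e.isOpen_inter_preimage_symm (hf.isOpen_inter_preimage hs e'.open_source)

theorem ManSmoothOn.of_locally [T2Space E'] [PolynormableSpace 𝕜 E] {f : M → M'} {s : Set M}
    (h : ∀ x ∈ s, ManSmoothAt 𝕜 E E' f x) : ManSmoothOn 𝕜 E E' f s := by
  refine ⟨fun x hx => ?_, fun e he e' he' => MBSmoothOn.of_locally fun y hy => ?_⟩
  · obtain ⟨V, hV, hxV, hf⟩ := h x hx
    exact (hf.1.continuousAt (hV.mem_nhds hxV)).continuousWithinAt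
  · obtain ⟨V, hV, hxV, hf⟩ := h _ hy.2.1
    exact ⟨_, isOpen_chart_domain hf.1 hV e e', ⟨hy.1, hxV, hy.2.2⟩, hf.2 e he e' he'⟩

theorem ManSmoothOn.manSmoothAt {f : M → M'} {s : Set M} (h : ManSmoothOn 𝕜 E E' f s)
    (hs : IsOpen s) {x : M} (hx : x ∈ s) : ManSmoothAt 𝕜 E E' f x := ⟨s, hs, hx, h⟩

theorem ManSmoothOn.congr [PolynormableSpace 𝕜 E] {f g : M → M'} {s : Set M}
    (h : ManSmoothOn 𝕜 E E' f s) (hs : IsOpen s) (hg : EqOn g f s) : ManSmoothOn 𝕜 E E' g s := by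
  refine ⟨h.1.congr hg, fun e he e' he' => ?_⟩
  have h1 : e.target ∩ e.symm ⁻¹' (s ∩ g ⁻¹' e'.source) =
      e.target ∩ e.symm ⁻¹' (s ∩ f ⁻¹' e'.source) := by
    ext x
    simp only [mem_inter_iff, mem_preimage, and_congr_right_iff]
    exact fun _ hx => by rw [hg hx]
  rw [h1]
  exact (h.2 e he e' he').congr (isOpen_chart_domain h.1 hs e e') fun x hx => by
    simp only [hg hx.2.1]

theorem ManSmoothAt.congr [PolynormableSpace 𝕜 E] {f g : M → M'} {x : M}
    (h : ManSmoothAt 𝕜 E E' f x) (hg : g =ᶠ[𝓝 x] f) : ManSmoothAt 𝕜 E E' g x := by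
  obtain ⟨U, hU, hxU, hf⟩ := h
  obtain ⟨V, hVg, hV, hxV⟩ := eventually_nhds_iff.1 hg
  exact ⟨U ∩ V, hU.inter hV, ⟨hxU, hxV⟩,
    (hf.mono inter_subset_left).congr (hU.inter hV) fun y hy => hVg y hy.2⟩

theorem ManSmoothOn.comp [PolynormableSpace 𝕜 E] [PolynormableSpace 𝕜 E']
    [PolynormableSpace 𝕜 E''] [T2Space E''] {g : M' → M''} {f : M → M'} {s : Set M} {t : Set M'}
    (hg : ManSmoothOn 𝕜 E' E'' g t) (hf : ManSmoothOn 𝕜 E E' f s) (ht : IsOpen t) (hs : IsOpen s)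
    (hst : MapsTo f s t) : ManSmoothOn 𝕜 E E'' (fun x => g (f x)) s := by
  refine ⟨hg.1.comp hf.1 hst, fun e he e'' he'' => MBSmoothOn.of_locally fun y hy => ?_⟩
  -- No single chart of `M'` need contain the image of `f`, so the expression in charts is factored
  -- through a chart at `f (e.symm y)` only near `y`.
  let e' := chartAt E' (f (e.symm y))
  have he' : e' ∈ atlas E' M' := chart_mem_atlas E' _
  have hgo := isOpen_chart_domain hg.1 ht e' e''
  have hfo := isOpen_chart_domain hf.1 hs e e'
  have h1 := hf.2 e he e' he'
  refine ⟨_, h1.continuousOn.isOpen_inter_preimage hfo hgo, ?_, ?_⟩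
  · have hy' : f (e.symm y) ∈ e'.source := mem_chart_source E' _
    refine ⟨⟨hy.1, hy.2.1, hy'⟩, e'.map_source hy', ?_⟩
    simp only [mem_preimage, e'.left_inv hy']
    exact ⟨hst hy.2.1, hy.2.2⟩
  · refine ((hg.2 e' he' e'' he'').comp (h1.mono inter_subset_left) hgo
      fun x hx => hx.2).congr (h1.continuousOn.isOpen_inter_preimage hfo hgo) fun x hx => ?_
    simp only [e'.left_inv hx.1.2.2]

theorem ManSmoothAt.comp [PolynormableSpace 𝕜 E] [PolynormableSpace 𝕜 E']
    [PolynormableSpace 𝕜 E''] [T2Space E''] {g : M' → M''} {f : M → M'} (x : M)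
    (hg : ManSmoothAt 𝕜 E' E'' g (f x)) (hf : ManSmoothAt 𝕜 E E' f x) :
    ManSmoothAt 𝕜 E E'' (fun x => g (f x)) x := by
  obtain ⟨V, hV, hxV, hg⟩ := hg
  obtain ⟨U, hU, hxU, hf⟩ := hf
  have ho := hf.1.isOpen_inter_preimage hU hV
  exact ⟨_, ho, ⟨hxU, hxV⟩, hg.comp (hf.mono inter_subset_left) hV ho fun y hy => hy.2⟩

theorem manSmoothOn_const (c : M') (s : Set M) : ManSmoothOn 𝕜 E E' (fun _ => c) s :=
  ⟨continuousOn_const, fun _ _ _ _ => MBSmoothOn.const _ _⟩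

theorem manSmoothAt_const (c : M') (x : M) : ManSmoothAt 𝕜 E E' (fun _ => c) x :=
  ⟨univ, isOpen_univ, mem_univ x, manSmoothOn_const c univ⟩

theorem ManSmoothOn.prodMk {f : M → M'} {g : M → M''} {s : Set M}
    (hf : ManSmoothOn 𝕜 E E' f s) (hg : ManSmoothOn 𝕜 E E'' g s) :
    ManSmoothOn 𝕜 E (E' × E'') (fun x => (f x, g x)) s := by
  refine ⟨hf.1.prodMk hg.1, ?_⟩
  rintro e he _ ⟨e', he', e'', he'', rfl⟩
  exact ((hf.2 e he e' he').mono fun x hx => ⟨hx.1, hx.2.1, hx.2.2.1⟩).prodMk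
    ((hg.2 e he e'' he'').mono fun x hx => ⟨hx.1, hx.2.1, hx.2.2.2⟩)

theorem ManSmoothAt.prodMk {f : M → M'} {g : M → M''} {x : M}
    (hf : ManSmoothAt 𝕜 E E' f x) (hg : ManSmoothAt 𝕜 E E'' g x) :
    ManSmoothAt 𝕜 E (E' × E'') (fun x => (f x, g x)) x := by
  obtain ⟨V, hV, hxV, hg⟩ := hg
  obtain ⟨U, hU, hxU, hf⟩ := hf
  exact ⟨U ∩ V, hU.inter hV, ⟨hxU, hxV⟩,
    (hf.mono inter_subset_left).prodMk (hg.mono inter_subset_right)⟩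

theorem manSmoothOn_id [MBManifold 𝕜 E M] (s : Set M) : ManSmoothOn 𝕜 E E (fun x : M => x) s :=
  ⟨continuousOn_id, fun e he e' he' => (MBManifold.isManifold e he e' he').mono fun x hx => by
    rw [OpenPartialHomeomorph.trans_source, e.symm_source]
    exact ⟨hx.1, hx.2.2⟩⟩

theorem manSmoothAt_id [MBManifold 𝕜 E M] (x : M) : ManSmoothAt 𝕜 E E (fun x : M => x) x :=
  ⟨univ, isOpen_univ, mem_univ x, manSmoothOn_id univ⟩

theorem manSmoothOn_fst [MBManifold 𝕜 E M] (s : Set (M × M')) :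
    ManSmoothOn 𝕜 (E × E') E (fun x : M × M' => x.1) s := by
  refine ⟨continuous_fst.continuousOn, ?_⟩
  rintro _ ⟨e, he, e', he', rfl⟩ e₁ he₁
  refine (MBManifold.isManifold e he e₁ he₁).comp_clm (ContinuousLinearMap.fst 𝕜 E E') ?_
  intro x hx
  rw [OpenPartialHomeomorph.trans_source, e.symm_source]
  exact ⟨hx.1.1, hx.2.2⟩

theorem manSmoothOn_snd [MBManifold 𝕜 E' M'] (s : Set (M × M')) :
    ManSmoothOn 𝕜 (E × E') E' (fun x : M × M' => x.2) s := by
  refine ⟨continuous_snd.continuousOn, ?_⟩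
  rintro _ ⟨e, he, e', he', rfl⟩ e₁ he₁
  refine (MBManifold.isManifold e' he' e₁ he₁).comp_clm (ContinuousLinearMap.snd 𝕜 E E') ?_
  intro x hx
  rw [OpenPartialHomeomorph.trans_source, e'.symm_source]
  exact ⟨hx.1.2, hx.2.2⟩

instance [MBManifold 𝕜 E M] [MBManifold 𝕜 E' M'] : MBManifold 𝕜 (E × E') (M × M') where
  isManifold := by
    rintro _ ⟨e, he, e', he', rfl⟩ _ ⟨e₁, he₁, e₁', he₁', rfl⟩
    have h1 : ∀ x : E × E', x ∈ ((e.prod e').symm.trans (e₁.prod e₁')).source →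
        x.1 ∈ (e.symm.trans e₁).source ∧ x.2 ∈ (e'.symm.trans e₁').source := by
      intro x hx
      simp only [OpenPartialHomeomorph.trans_source] at hx ⊢
      exact ⟨⟨hx.1.1, hx.2.1⟩, ⟨hx.1.2, hx.2.2⟩⟩
    exact ((MBManifold.isManifold e he e₁ he₁).comp_clm (ContinuousLinearMap.fst 𝕜 E E')
      fun x hx => (h1 x hx).1).prodMk ((MBManifold.isManifold e' he' e₁' he₁').comp_clm
        (ContinuousLinearMap.snd 𝕜 E E') fun x hx => (h1 x hx).2)

variable [PolynormableSpace 𝕜 E] [PolynormableSpace 𝕜 E'] [PolynormableSpace 𝕜 E'']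

theorem ManSmoothAt.fst [MBManifold 𝕜 E' M'] [T2Space E'] {f : M → M' × M''} {x : M}
    (hf : ManSmoothAt 𝕜 E (E' × E'') f x) : ManSmoothAt 𝕜 E E' (fun x => (f x).1) x :=
  .comp (g := fun z : M' × M'' => z.1) x ⟨univ, isOpen_univ, mem_univ _, manSmoothOn_fst _⟩ hf

theorem ManSmoothAt.snd [MBManifold 𝕜 E'' M''] [T2Space E''] {f : M → M' × M''} {x : M}
    (hf : ManSmoothAt 𝕜 E (E' × E'') f x) : ManSmoothAt 𝕜 E E'' (fun x => (f x).2) x :=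
  .comp (g := fun z : M' × M'' => z.2) x ⟨univ, isOpen_univ, mem_univ _, manSmoothOn_snd _⟩ hf

end Manifolds

/-! ### Lie groups -/

section LieGroups

variable {𝕜 : Type w} [RCLike 𝕜]
  {E : Type w₁} [AddCommGroup E] [Module 𝕜 E] [TopologicalSpace E] [PolynormableSpace 𝕜 E]
  {E' : Type w₂} [AddCommGroup E'] [Module 𝕜 E'] [TopologicalSpace E'] [PolynormableSpace 𝕜 E']
  [T2Space E']
  {M : Type u} [TopologicalSpace M] [ChartedSpace E M]
  {H : Type v} [Group H] [TopologicalSpace H] [ChartedSpace E' H] [IsMBLieGroup 𝕜 E' H]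

instance (priority := low) IsMBLieGroup.toMBManifold : MBManifold 𝕜 E' H :=
  ⟨IsMBLieGroup.isManifold⟩

theorem ManSmoothAt.mul {f g : M → H} {x : M} (hf : ManSmoothAt 𝕜 E E' f x)
    (hg : ManSmoothAt 𝕜 E E' g x) : ManSmoothAt 𝕜 E E' (fun x => f x * g x) x :=
  .comp (g := fun p : H × H => p.1 * p.2) x
    ⟨univ, isOpen_univ, mem_univ _, IsMBLieGroup.smooth_mul⟩ (hf.prodMk hg)

theorem ManSmoothAt.inv {f : M → H} {x : M} (hf : ManSmoothAt 𝕜 E E' f x) :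
    ManSmoothAt 𝕜 E E' (fun x => (f x)⁻¹) x :=
  .comp (g := fun p : H => p⁻¹) x ⟨univ, isOpen_univ, mem_univ _, IsMBLieGroup.smooth_inv⟩ hf

variable [T2Space E]
  {G : Type u'} [Group G] [TopologicalSpace G] [ChartedSpace E G] [IsMBLieGroup 𝕜 E G]

/-- A homomorphism of Lie groups that is smooth near `1` is smooth. -/
theorem MonoidHom.manSmoothOn_of_manSmoothAt_one (φ : G →* H) (h : ManSmoothAt 𝕜 E E' φ 1) :
    ManSmoothOn 𝕜 E E' φ univ := by
  refine .of_locally fun a _ => ?_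
  -- Near `a`, write `φ x = φ a * φ (a⁻¹ * x)`; the inner argument is near `1`.
  have h1 : ManSmoothAt 𝕜 E E' (fun x => φ a * φ (a⁻¹ * x)) a := by
    refine (manSmoothAt_const _ _).mul (ManSmoothAt.comp (g := φ) a ?_
      ((manSmoothAt_const _ _).mul (manSmoothAt_id a)))
    rwa [inv_mul_cancel]
  simpa [← map_mul] using h1

theorem IsMBLieGroup.isTopologicalGroup (𝕜 : Type w) [RCLike 𝕜] (E : Type w₁) [AddCommGroup E]
    [Module 𝕜 E] [TopologicalSpace E] (G : Type u') [Group G] [TopologicalSpace G]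
    [ChartedSpace E G] [IsMBLieGroup 𝕜 E G] : IsTopologicalGroup G where
  continuous_mul := continuousOn_univ.1 (IsMBLieGroup.smooth_mul (𝕜 := 𝕜) (E := E)).1
  continuous_inv := continuousOn_univ.1 (IsMBLieGroup.smooth_inv (𝕜 := 𝕜) (E := E)).1

end LieGroups

/-! ### Lie groups from local data -/

/-- A group `K` together with a bijection onto a manifold `P` for which the group operations are
smooth near the identity: `V` is an open subset of `P` containing the identity, all left
translations of `K` are smooth where they map `V` to `V`, and multiplication, inversion, and all
conjugations are smooth at the identity. -/
structure LocalLieData (𝕜 : Type w) [RCLike 𝕜]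
    (E : Type w₁) [AddCommGroup E] [Module 𝕜 E] [TopologicalSpace E]
    (P : Type u) [TopologicalSpace P] [ChartedSpace E P] (K : Type v) [Group K] where
  equiv : P ≃ K
  nhd : Set P
  isOpen_nhd : IsOpen nhd
  one_mem : equiv.symm 1 ∈ nhd
  smooth_left : ∀ k : K, ManSmoothOn 𝕜 E E (fun p => equiv.symm (k * equiv p))
    (nhd ∩ {p | equiv.symm (k * equiv p) ∈ nhd})
  isOpen_left : ∀ k : K, IsOpen (nhd ∩ {p | equiv.symm (k * equiv p) ∈ nhd})
  smooth_mul : ManSmoothAt 𝕜 (E × E) E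
    (fun p : P × P => equiv.symm (equiv p.1 * equiv p.2)) (equiv.symm 1, equiv.symm 1)
  smooth_inv : ManSmoothAt 𝕜 E E (fun p => equiv.symm (equiv p)⁻¹) (equiv.symm 1)
  smooth_conj : ∀ k : K, ManSmoothAt 𝕜 E E
    (fun p => equiv.symm (k * equiv p * k⁻¹)) (equiv.symm 1)

namespace LocalLieData

variable {𝕜 : Type w} [RCLike 𝕜]
  {E : Type w₁} [AddCommGroup E] [Module 𝕜 E] [TopologicalSpace E]
  {P : Type u} [TopologicalSpace P] [ChartedSpace E P] {K : Type v} [Group K]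
  (D : LocalLieData 𝕜 E P K)

/-- The translate by `k` of the chart `e`. -/
def chart (k : K) (e : OpenPartialHomeomorph P E) : PartialEquiv K E where
  toFun y := e (D.equiv.symm (k⁻¹ * y))
  invFun u := k * D.equiv (e.symm u)
  source := {y | D.equiv.symm (k⁻¹ * y) ∈ D.nhd ∩ e.source}
  target := e.target ∩ e.symm ⁻¹' D.nhd
  map_source' y hy := ⟨e.map_source hy.2, by simpa [e.left_inv hy.2] using hy.1⟩
  map_target' u hu := by
    simpa using (⟨hu.2, e.map_target hu.1⟩ : e.symm u ∈ D.nhd ∩ e.source)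
  left_inv' y hy := by simp [e.left_inv hy.2]
  right_inv' u hu := by simp [e.right_inv hu.1]

theorem chart_trans_source (k k' : K) (e e' : OpenPartialHomeomorph P E) :
    ((D.chart k e).symm.trans (D.chart k' e')).source =
      e.target ∩ e.symm ⁻¹' ((D.nhd ∩ {p | D.equiv.symm (k'⁻¹ * k * D.equiv p) ∈ D.nhd}) ∩
        (fun p => D.equiv.symm (k'⁻¹ * k * D.equiv p)) ⁻¹' e'.source) := by
  ext u
  simp [chart, PartialEquiv.trans_source, mul_assoc, and_assoc]

/-- In the coordinates of `P`, passing from the chart at `k` to the chart at `k'` is left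
translation by `k'⁻¹ * k`, restricted to where it maps `nhd` into itself. This is what `smooth_left`
covers. -/
theorem mbSmoothOn_chart_trans (k k' : K) {e e' : OpenPartialHomeomorph P E}
    (he : e ∈ atlas E P) (he' : e' ∈ atlas E P) :
    MBSmoothOn 𝕜 ((D.chart k e).symm.trans (D.chart k' e'))
      ((D.chart k e).symm.trans (D.chart k' e')).source := by
  rw [chart_trans_source]
  have h := (D.smooth_left (k'⁻¹ * k)).2 e he e' he'
  simp only [mul_assoc] at h ⊢
  exact h

/-- The atlas that consists of the left translates of the charts of `P`. -/
def core : ChartedSpaceCore E K where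
  atlas := {c | ∃ k : K, ∃ e ∈ atlas E P, c = D.chart k e}
  chartAt y := D.chart y (chartAt E (D.equiv.symm 1))
  mem_chart_source y := by
    simpa [chart] using D.one_mem
  chart_mem_atlas y := ⟨y, _, chart_mem_atlas E _, rfl⟩
  open_source := by
    rintro _ _ ⟨k, e, he, rfl⟩ ⟨k', e', he', rfl⟩
    rw [chart_trans_source]
    exact isOpen_chart_domain (D.smooth_left _).1 (D.isOpen_left _) e e'
  continuousOn_toFun := by
    rintro _ _ ⟨k, e, he, rfl⟩ ⟨k', e', he', rfl⟩
    exact (D.mbSmoothOn_chart_trans k k' he he').continuousOn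

/-- The group `K` with the Lie group structure defined by the local data. -/
def Space (_D : LocalLieData 𝕜 E P K) := K

instance : Group D.Space := inferInstanceAs (Group K)

instance : TopologicalSpace D.Space := D.core.toTopologicalSpace

instance : ChartedSpace E D.Space := D.core.toChartedSpace

theorem chart_mem_core (k : K) {e : OpenPartialHomeomorph P E} (he : e ∈ atlas E P) :
    D.chart k e ∈ D.core.atlas := ⟨k, e, he, rfl⟩

/-- The translate by `k` of the chart `e`, as a partial homeomorphism. -/
def homeo (k : K) {e : OpenPartialHomeomorph P E} (he : e ∈ atlas E P) :
    OpenPartialHomeomorph D.Space E := D.core.openPartialHomeomorph _ (D.chart_mem_core k he)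

theorem mem_atlas_iff {c : OpenPartialHomeomorph D.Space E} :
    c ∈ atlas E D.Space ↔ ∃ (k : K) (e : OpenPartialHomeomorph P E) (he : e ∈ atlas E P),
      c = D.homeo k he := by
  change c ∈ ⋃ (e : PartialEquiv K E) (he : e ∈ D.core.atlas), {_} ↔ _
  simp only [mem_iUnion]
  constructor
  · rintro ⟨_, ⟨k, e, he, rfl⟩, rfl⟩
    exact ⟨k, e, he, rfl⟩
  · rintro ⟨k, e, he, rfl⟩
    exact ⟨_, D.chart_mem_core k he, rfl⟩

instance : MBManifold 𝕜 E D.Space where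
  isManifold := by
    intro c hc c' hc'
    obtain ⟨k, e, he, rfl⟩ := D.mem_atlas_iff.1 hc
    obtain ⟨k', e', he', rfl⟩ := D.mem_atlas_iff.1 hc'
    exact D.mbSmoothOn_chart_trans k k' he he'

/-- The bijection from `P` onto the Lie group. -/
def spaceEquiv : P ≃ D.Space := D.equiv

/-- The coordinates centered at `k`. -/
def coord (k y : D.Space) : P := D.spaceEquiv.symm (k⁻¹ * y)

/-- The parametrization centered at `k`. -/
def param (k : D.Space) (p : P) : D.Space := k * D.spaceEquiv p

theorem coord_self (k : D.Space) : D.coord k k = D.equiv.symm 1 := by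
  rw [coord, inv_mul_cancel]
  rfl

theorem param_coord (a k y : D.Space) : D.param (a * k) (D.coord k y) = a * y := by
  rw [param, coord, Equiv.apply_symm_apply, mul_assoc, mul_inv_cancel_left]

theorem param_one_coord (y : D.Space) : D.param 1 (D.coord 1 y) = y := by
  simpa using D.param_coord 1 1 y

theorem param_equiv_symm_one (k : D.Space) : D.param k (D.equiv.symm 1) = k := by
  rw [← D.coord_self k]
  simpa using D.param_coord 1 k k

theorem isOpen_coord_preimage (k : D.Space) : IsOpen {y : D.Space | D.coord k y ∈ D.nhd} := by
  have : {y : D.Space | D.coord k y ∈ D.nhd} =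
      ⋃ (e : OpenPartialHomeomorph P E) (he : e ∈ atlas E P), (D.homeo k he).source := by
    ext y
    simp only [mem_iUnion]
    constructor
    · intro hy
      exact ⟨chartAt E (D.coord k y), chart_mem_atlas E _, hy, mem_chart_source E _⟩
    · rintro ⟨e, he, hy⟩
      exact hy.1
  rw [this]
  exact isOpen_iUnion fun e => isOpen_iUnion fun he => (D.homeo k he).open_source

theorem manSmoothOn_coord (k : D.Space) :
    ManSmoothOn 𝕜 E E (D.coord k) {y : D.Space | D.coord k y ∈ D.nhd} := by
  refine ⟨fun y hy => ?_, ?_⟩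
  · let e := chartAt E (D.coord k y)
    have he : e ∈ atlas E P := chart_mem_atlas E _
    have hys : y ∈ (D.homeo k he).source := ⟨hy, mem_chart_source E _⟩
    have h1 : ContinuousAt (fun z => e.symm (D.homeo k he z)) y :=
      ContinuousAt.comp (e.continuousAt_symm ((D.homeo k he).map_source hys).1)
        ((D.homeo k he).continuousAt hys)
    refine (h1.congr ?_).continuousWithinAt
    filter_upwards [(D.homeo k he).open_source.mem_nhds hys] with z hz
    exact e.left_inv hz.2
  · intro c hc e' he'
    obtain ⟨k', e, he, rfl⟩ := D.mem_atlas_iff.1 hc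
    have h := D.mbSmoothOn_chart_trans k' k he he'
    refine MBSmoothOn.mono h fun x hx => ?_
    rw [PartialEquiv.trans_source]
    exact ⟨hx.1, hx.2⟩

theorem manSmoothOn_param (k : D.Space) : ManSmoothOn 𝕜 E E (D.param k) D.nhd := by
  refine ⟨fun p hp => ?_, ?_⟩
  · let e := chartAt E p
    have he : e ∈ atlas E P := chart_mem_atlas E _
    have hpe : p ∈ e.source := mem_chart_source E _
    have h1 : ContinuousAt (fun z => (D.homeo k he).symm (e z)) p := by
      refine ContinuousAt.comp ((D.homeo k he).continuousAt_symm ⟨e.map_source hpe, ?_⟩)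
        (e.continuousAt hpe)
      simpa only [mem_preimage, e.left_inv hpe] using hp
    refine (h1.congr ?_).continuousWithinAt
    filter_upwards [e.open_source.mem_nhds hpe] with z hz
    change D.param k (e.symm (e z)) = _
    rw [e.left_inv hz]
  · intro e he c hc
    obtain ⟨k', e', he', rfl⟩ := D.mem_atlas_iff.1 hc
    have h : MBSmoothOn 𝕜 (fun x => D.homeo k' he' (D.param k (e.symm x))) _ :=
      D.mbSmoothOn_chart_trans k k' he he'
    refine h.mono fun x hx => ?_
    rw [PartialEquiv.trans_source]
    exact ⟨⟨hx.1, hx.2.1⟩, hx.2.2⟩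

theorem manSmoothAt_coord (k : D.Space) : ManSmoothAt 𝕜 E E (D.coord k) k :=
  (D.manSmoothOn_coord k).manSmoothAt (D.isOpen_coord_preimage k) (by
    simpa only [mem_ofPred_eq, coord_self] using D.one_mem)

theorem manSmoothAt_param (k : D.Space) : ManSmoothAt 𝕜 E E (D.param k) (D.equiv.symm 1) :=
  (D.manSmoothOn_param k).manSmoothAt D.isOpen_nhd D.one_mem

/-! ### Smoothness of the group operations in the translated charts -/

variable [PolynormableSpace 𝕜 E] [T2Space E]

/-- Read in coordinates centered at `y` and at `a * y`, left translation by `a` is the identity of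
`P`, because the atlas is invariant under left translations. -/
theorem manSmoothAt_mul_left (a y : D.Space) : ManSmoothAt 𝕜 E E (fun z => a * z) y := by
  have h := ManSmoothAt.comp (g := D.param (a * y)) y
    (by simpa only [coord_self] using D.manSmoothAt_param (a * y)) (D.manSmoothAt_coord y)
  simpa only [param_coord] using h

/-- Maps of `K` that are smooth at the identity in the coordinates of `P`. -/
theorem manSmoothAt_one_of_coord {F : D.Space → D.Space}
    (hF : ManSmoothAt 𝕜 E E (fun p => D.coord 1 (F (D.param 1 p))) (D.equiv.symm 1))
    (h1 : F 1 = 1) : ManSmoothAt 𝕜 E E F 1 := by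
  have h2 := ManSmoothAt.comp (g := fun p => D.coord 1 (F (D.param 1 p))) (f := D.coord 1) 1
    (by simpa only [coord_self] using hF) (D.manSmoothAt_coord 1)
  have h3 := ManSmoothAt.comp (g := D.param 1) 1 (by
    simpa only [coord_self, param_equiv_symm_one, h1] using D.manSmoothAt_param 1) h2
  simpa only [param_one_coord] using h3

theorem manSmoothAt_inv_one : ManSmoothAt 𝕜 E E (fun z : D.Space => z⁻¹) 1 := by
  refine D.manSmoothAt_one_of_coord ?_ inv_one
  simp only [coord, param, inv_one, one_mul]
  exact D.smooth_inv

theorem manSmoothAt_conj_one (k : D.Space) :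
    ManSmoothAt 𝕜 E E (fun z : D.Space => k * z * k⁻¹) 1 := by
  refine D.manSmoothAt_one_of_coord ?_ (by simp)
  simp only [coord, param, inv_one, one_mul]
  exact D.smooth_conj k

theorem manSmoothAt_mul_one :
    ManSmoothAt 𝕜 (E × E) E (fun z : D.Space × D.Space => z.1 * z.2)
      ((1, 1) : D.Space × D.Space) := by
  have hid := manSmoothAt_id (𝕜 := 𝕜) (E := E × E) ((1, 1) : D.Space × D.Space)
  have h1 : ManSmoothAt 𝕜 (E × E) (E × E)
      (fun z : D.Space × D.Space => (D.coord 1 z.1, D.coord 1 z.2)) ((1, 1) : D.Space × D.Space) :=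
    (ManSmoothAt.comp (g := D.coord 1) (1, 1) (D.manSmoothAt_coord 1) hid.fst).prodMk
      (ManSmoothAt.comp (g := D.coord 1) (1, 1) (D.manSmoothAt_coord 1) hid.snd)
  have h2 := ManSmoothAt.comp
    (g := fun p : P × P => D.equiv.symm (D.equiv p.1 * D.equiv p.2)) _
    (by simpa only [coord_self] using D.smooth_mul) h1
  have h3 := ManSmoothAt.comp (g := D.param 1) _ (by
    have h := D.manSmoothAt_param 1
    simpa [coord_self] using h) h2
  refine h3.congr (.of_forall fun z => ?_)
  have h4 : ∀ y : D.Space, (D.equiv (D.coord 1 y) : K) = y := fun y => by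
    have h := D.param_one_coord y
    rw [param, one_mul] at h
    exact h
  simp only [param, h4, one_mul]
  exact (D.equiv.apply_symm_apply _).symm

instance : IsMBLieGroup 𝕜 E D.Space where
  isManifold := MBManifold.isManifold
  smooth_mul := by
    refine .of_locally ?_
    rintro ⟨a, b⟩ -
    have hid := manSmoothAt_id (𝕜 := 𝕜) (E := E × E) ((a, b) : D.Space × D.Space)
    -- The operations are reduced to `1` by `x y = (a b) · (b⁻¹ (a⁻¹ x) b) · (b⁻¹ y)`: for `(x, y)`
    -- near `(a, b)` the last two factors are near `1`. Conjugation by `b⁻¹` is needed since only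
    -- left translations are known to be smooth everywhere.
    have h1 : ManSmoothAt 𝕜 (E × E) E (fun z : D.Space × D.Space => a⁻¹ * z.1) (a, b) :=
      .comp (g := fun z => a⁻¹ * z) _ (D.manSmoothAt_mul_left _ _) hid.fst
    have h2 : ManSmoothAt 𝕜 (E × E) E (fun z : D.Space × D.Space => b⁻¹ * z.2) (a, b) :=
      .comp (g := fun z => b⁻¹ * z) _ (D.manSmoothAt_mul_left _ _) hid.snd
    have h3 : ManSmoothAt 𝕜 (E × E) E
        (fun z : D.Space × D.Space => b⁻¹ * (a⁻¹ * z.1) * b⁻¹⁻¹) (a, b) :=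
      .comp (g := fun z => b⁻¹ * z * b⁻¹⁻¹) _
        (by simpa only [inv_mul_cancel] using D.manSmoothAt_conj_one b⁻¹) h1
    have h4 := ManSmoothAt.comp (g := fun z : D.Space × D.Space => z.1 * z.2) (a, b)
      (by simpa using D.manSmoothAt_mul_one) (h3.prodMk h2)
    have h5 := ManSmoothAt.comp (g := fun z => a * b * z) (a, b)
      (D.manSmoothAt_mul_left _ _) h4
    simpa [mul_assoc] using h5
  smooth_inv := by
    refine .of_locally fun a _ => ?_
    -- Here the reduction is `x⁻¹ = a⁻¹ · (a (a⁻¹ x)⁻¹ a⁻¹)`.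
    have h1 : ManSmoothAt 𝕜 E E (fun z : D.Space => (a⁻¹ * z)⁻¹) a :=
      .comp (g := fun z => z⁻¹) _ (by simpa only [inv_mul_cancel] using D.manSmoothAt_inv_one)
        (D.manSmoothAt_mul_left _ _)
    have h2 : ManSmoothAt 𝕜 E E (fun z : D.Space => a * (a⁻¹ * z)⁻¹ * a⁻¹) a :=
      .comp (g := fun z => a * z * a⁻¹) _
        (by simpa only [inv_mul_cancel, inv_one] using D.manSmoothAt_conj_one a) h1
    have h3 := ManSmoothAt.comp (g := fun z => a⁻¹ * z) a (D.manSmoothAt_mul_left _ _) h2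
    simpa [mul_assoc] using h3

omit [PolynormableSpace 𝕜 E] [T2Space E] in
theorem isDiffeoOn_spaceEquiv : IsDiffeoOn 𝕜 E E D.spaceEquiv D.nhd
    (D.spaceEquiv.symm ⁻¹' D.nhd) := by
  have h1 : D.param 1 = D.spaceEquiv := funext fun p => one_mul (D.spaceEquiv p)
  have h2 : D.coord 1 = D.spaceEquiv.symm := by
    ext y
    rw [coord, inv_one, one_mul]
  have h3 := D.isOpen_coord_preimage 1
  have h4 := D.manSmoothOn_coord 1
  rw [h2] at h3 h4
  refine ⟨D.isOpen_nhd, h3, D.spaceEquiv.bijOn fun p => ?_, h1 ▸ D.manSmoothOn_param 1,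
    D.spaceEquiv.symm, ⟨fun p _ => D.spaceEquiv.symm_apply_apply p,
      fun y _ => D.spaceEquiv.apply_symm_apply y⟩, h4⟩
  simp

end LocalLieData

/-! ### The action of locally smooth maps on smooth factor systems -/

section Action

variable {𝕜 : Type w} [RCLike 𝕜]
  {EG : Type w₁} [AddCommGroup EG] [Module 𝕜 EG] [TopologicalSpace EG]
  {EN : Type w₂} [AddCommGroup EN] [Module 𝕜 EN] [TopologicalSpace EN]
  {G : Type u} [Group G] [TopologicalSpace G] [ChartedSpace EG G]
  {N : Type v} [Group N] [TopologicalSpace N] [ChartedSpace EN N]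

namespace SmoothFactorSystem

theorem S_one (f : SmoothFactorSystem 𝕜 EG EN G N) : f.S 1 = 1 := f.isC1sAut.2.1

theorem ω_one_right (f : SmoothFactorSystem 𝕜 EG EN G N) (g : G) : f.ω g 1 = 1 :=
  (f.isC2ss.1.2 g).1

theorem ω_one_left (f : SmoothFactorSystem 𝕜 EG EN G N) (g : G) : f.ω 1 g = 1 :=
  (f.isC2ss.1.2 g).2

theorem smoothAt_S (f : SmoothFactorSystem 𝕜 EG EN G N) (g : G) (n : N) :
    ManSmoothAt 𝕜 EN EN (f.S g) n :=
  ⟨univ, isOpen_univ, mem_univ n, (f.isC1sAut.1 g).1⟩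

theorem smoothAt_S_prod (f : SmoothFactorSystem 𝕜 EG EN G N) (n : N) :
    ManSmoothAt 𝕜 (EG × EN) EN (fun p : G × N => f.S p.1 p.2) (1, n) :=
  let ⟨U, hU, h1, h⟩ := f.isC1sAut.2.2
  ⟨U ×ˢ univ, hU.prod isOpen_univ, ⟨h1, mem_univ n⟩, h⟩

theorem smoothAt_ω (f : SmoothFactorSystem 𝕜 EG EN G N) :
    ManSmoothAt 𝕜 (EG × EG) EN (fun p : G × G => f.ω p.1 p.2) (1, 1) := f.isC2ss.1.1

theorem smoothAt_ω_conj (f : SmoothFactorSystem 𝕜 EG EN G N) (g : G) :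
    ManSmoothAt 𝕜 EG EN (fun x : G => f.ω g x * (f.ω (g * x * g⁻¹) g)⁻¹) 1 := f.isC2ss.2 g

end SmoothFactorSystem

variable [PolynormableSpace 𝕜 EG] [T2Space EG] [PolynormableSpace 𝕜 EN] [T2Space EN]
  [IsMBLieGroup 𝕜 EG G] [IsMBLieGroup 𝕜 EN N]

namespace SmoothFactorSystem

variable {E : Type w₃} [AddCommGroup E] [Module 𝕜 E] [TopologicalSpace E] [PolynormableSpace 𝕜 E]
  {M : Type u'} [TopologicalSpace M] [ChartedSpace E M]

omit [T2Space EG] [IsMBLieGroup 𝕜 EG G] [IsMBLieGroup 𝕜 EN N] in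
theorem smoothAt_S_comp (f : SmoothFactorSystem 𝕜 EG EN G N) {a : M → G} {b : M → N} {x : M}
    (ha : ManSmoothAt 𝕜 E EG a x) (hb : ManSmoothAt 𝕜 E EN b x) (h1 : a x = 1) :
    ManSmoothAt 𝕜 E EN (fun y => f.S (a y) (b y)) x :=
  .comp (g := fun p : G × N => f.S p.1 p.2) x (by rw [h1]; exact f.smoothAt_S_prod _)
    (ha.prodMk hb)

omit [T2Space EG] [IsMBLieGroup 𝕜 EG G] [IsMBLieGroup 𝕜 EN N] in
theorem smoothAt_ω_comp (f : SmoothFactorSystem 𝕜 EG EN G N) {a b : M → G} {x : M}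
    (ha : ManSmoothAt 𝕜 E EG a x) (hb : ManSmoothAt 𝕜 E EG b x) (h1 : a x = 1) (h2 : b x = 1) :
    ManSmoothAt 𝕜 E EN (fun y => f.ω (a y) (b y)) x :=
  .comp (g := fun p : G × G => f.ω p.1 p.2) x (by rw [h1, h2]; exact f.smoothAt_ω)
    (ha.prodMk hb)

omit [PolynormableSpace 𝕜 EG] [T2Space EG] [IsMBLieGroup 𝕜 EG G] [IsMBLieGroup 𝕜 EN N] in
theorem smoothAt_S_apply_comp (f : SmoothFactorSystem 𝕜 EG EN G N) (g : G) {b : M → N} {x : M}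
    (hb : ManSmoothAt 𝕜 E EN b x) : ManSmoothAt 𝕜 E EN (fun y => f.S g (b y)) x :=
  .comp (g := f.S g) x (f.smoothAt_S g _) hb

end SmoothFactorSystem

omit [T2Space EG] [IsMBLieGroup 𝕜 EG G] [IsMBLieGroup 𝕜 EN N] in
theorem IsC1s.smoothAt_comp {E : Type w₃} [AddCommGroup E] [Module 𝕜 E] [TopologicalSpace E]
    [PolynormableSpace 𝕜 E] {M : Type u'} [TopologicalSpace M] [ChartedSpace E M] {h : G → N}
    (hh : IsC1s 𝕜 EG EN h) {a : M → G} {x : M} (ha : ManSmoothAt 𝕜 E EG a x) (h1 : a x = 1) :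
    ManSmoothAt 𝕜 E EN (fun y => h (a y)) x :=
  .comp (g := h) x (by rw [h1]; exact hh.1) ha

omit [T2Space EG] [IsMBLieGroup 𝕜 EG G] [IsMBLieGroup 𝕜 EN N] in
/-- The map `(g, n) ↦ S g n` is smooth on a product `U × N` as soon as it is smooth at all
points `(g, n)` with `g ∈ U`. -/
theorem isC1sAut_of {S : G → MulAut N} (h1 : ∀ g, IsLieAut 𝕜 EN (S g)) (h2 : S 1 = 1) {U : Set G}
    (hU : IsOpen U) (h1U : 1 ∈ U)
    (h : ∀ g ∈ U, ∀ n, ManSmoothAt 𝕜 (EG × EN) EN (fun p : G × N => S p.1 p.2) (g, n)) :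
    IsC1sAut 𝕜 EG EN S :=
  ⟨h1, h2, U, hU, h1U, .of_locally fun p hp => h p.1 hp.1 p.2⟩

variable (𝕜 EG EN G N) in
/-- The group `C^1_s(G,N)` of normalized locally smooth maps. -/
def c1sSubgroup : Subgroup (G → N) where
  carrier := {h | IsC1s 𝕜 EG EN h}
  one_mem' := ⟨manSmoothAt_const _ _, rfl⟩
  mul_mem' := fun ha hb => ⟨ManSmoothAt.mul ha.1 hb.1, by simp [ha.2, hb.2]⟩
  inv_mem' := fun ha => ⟨ManSmoothAt.inv ha.1, by simp [ha.2]⟩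

theorem isLieAut_conj_mul (n : N) {φ : MulAut N} (hφ : IsLieAut 𝕜 EN φ) :
    IsLieAut 𝕜 EN (MulAut.conj n * φ) := by
  constructor
  · refine .of_locally fun x _ => ?_
    have h : ManSmoothAt 𝕜 EN EN φ x := hφ.1.manSmoothAt isOpen_univ (mem_univ x)
    exact ((manSmoothAt_const n x).mul h).mul (manSmoothAt_const n⁻¹ x)
  · refine .of_locally fun x _ => ?_
    have h : ManSmoothAt 𝕜 EN EN φ.symm (n⁻¹ * x * n) :=
      hφ.2.manSmoothAt isOpen_univ (mem_univ _)
    exact ManSmoothAt.comp (g := φ.symm) x h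
      (((manSmoothAt_const n⁻¹ x).mul (manSmoothAt_id x)).mul (manSmoothAt_const n x))

namespace SmoothFactorSystem

/-- The factor system `h.(S, ω)`. -/
def act (h : G → N) (hh : IsC1s 𝕜 EG EN h) (f : SmoothFactorSystem 𝕜 EG EN G N) :
    SmoothFactorSystem 𝕜 EG EN G N where
  S := actS h f.S
  ω := actOmega h f.S f.ω
  isC1sAut := by
    obtain ⟨U, hU, h1U, hS⟩ := f.isC1sAut.2.2
    obtain ⟨V, hV, h1V, hhV⟩ := hh.1
    refine isC1sAut_of (fun g => isLieAut_conj_mul _ (f.isC1sAut.1 g)) ?_ (hU.inter hV)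
      ⟨h1U, h1V⟩ fun g hg n => ?_
    · rw [actS, hh.2, f.S_one, map_one, one_mul]
    · have hS' := hS.manSmoothAt (hU.prod isOpen_univ) (x := (g, n)) ⟨hg.1, mem_univ n⟩
      have hh' := ManSmoothAt.comp (g := h) (g, n) (hhV.manSmoothAt hV hg.2)
        (manSmoothAt_id (𝕜 := 𝕜) (E := EG × EN) (g, n)).fst
      exact (hh'.mul hS').mul hh'.inv
  isC2ss := by
    refine ⟨⟨?_, fun g => ⟨?_, ?_⟩⟩, fun g => ?_⟩
    · have hid := manSmoothAt_id (𝕜 := 𝕜) (E := EG × EG) ((1, 1) : G × G)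
      have h1 := hh.smoothAt_comp hid.fst rfl
      have h2 := hh.smoothAt_comp hid.snd rfl
      have h3 := hh.smoothAt_comp (hid.fst.mul hid.snd) (mul_one 1)
      exact ((h1.mul (f.smoothAt_S_comp hid.fst h2 rfl)).mul f.smoothAt_ω).mul h3.inv
    · simp [actOmega, hh.2, f.ω_one_right]
    · simp [actOmega, hh.2, f.ω_one_left, f.S_one]
    · have hid := manSmoothAt_id (𝕜 := 𝕜) (E := EG) (1 : G)
      have hc : ManSmoothAt 𝕜 EG EG (fun x => g * x * g⁻¹) (1 : G) :=
        ((manSmoothAt_const _ _).mul hid).mul (manSmoothAt_const _ _)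
      have h1 := f.smoothAt_S_apply_comp g (hh.smoothAt_comp hid rfl)
      have h2 := f.smoothAt_S_comp hc (manSmoothAt_const (h g)⁻¹ 1) (by simp)
      have h3 := hh.smoothAt_comp hc (by simp)
      -- In the quotient for the new cocycle the factors `h(g x)` cancel, although `h` need not be
      -- smooth near `g`. What remains is `h(g) · S(g)(h(x)) · ω_g(x) · S(g x g⁻¹)(h(g)⁻¹) · h(g x
      -- g⁻¹)⁻¹`.
      have h4 := (((((manSmoothAt_const (h g) _).mul h1).mul (f.smoothAt_ω_conj g)).mul h2).mul
        h3.inv)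
      refine ManSmoothAt.congr h4 (.of_forall fun x => ?_)
      simp [actOmega, mul_assoc]
  delta_eq g g' := by
    have key : actS h f.S g * actS h f.S g' =
        MulAut.conj (actOmega h f.S f.ω g g') * actS h f.S (g * g') := by
      ext n
      simp [actS, actOmega, TwistedProduct.S_S, mul_assoc]
    rw [key, mul_inv_cancel_right]
  d_eq_one g g' g'' := by
    rw [mul_inv_eq_one, mul_inv_eq_iff_eq_mul]
    -- The cocycle identity solved for `S g (ω g' g'')`, the term that arises when `S g` is applied
    -- to the new cocycle.
    have h1 := eq_mul_inv_of_mul_eq (TwistedProduct.S_omega f g g' g'')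
    simp [actS, actOmega, TwistedProduct.S_S, mul_assoc, h1]

end SmoothFactorSystem

/-- The action of `C^1_s(G,N)` on smooth factor systems. -/
@[reducible]
def c1sMulAction : MulAction (c1sSubgroup 𝕜 EG EN G N) (SmoothFactorSystem 𝕜 EG EN G N) where
  smul h f := f.act h h.2
  one_smul f := by
    ext g x
    · change MulAut.conj 1 (f.S g x) = _
      simp
    · change 1 * f.S g 1 * f.ω g x * 1⁻¹ = _
      simp
  mul_smul h h' f := by
    ext g x
    · change MulAut.conj (h.1 g * h'.1 g) (f.S g x) =
        MulAut.conj (h.1 g) (MulAut.conj (h'.1 g) (f.S g x))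
      simp
    · change h.1 g * h'.1 g * f.S g (h.1 x * h'.1 x) * f.ω g x * (h.1 (g * x) * h'.1 (g * x))⁻¹ =
        h.1 g * (MulAut.conj (h'.1 g) (f.S g (h.1 x))) *
          (h'.1 g * f.S g (h'.1 x) * f.ω g x * (h'.1 (g * x))⁻¹) * (h.1 (g * x))⁻¹
      simp [mul_assoc]

end Action

/-! ### The Lie group structure of `N ×_(S,ω) G` -/

section Twisted

variable {𝕜 : Type w} [RCLike 𝕜]
  {EG : Type w₁} [AddCommGroup EG] [Module 𝕜 EG] [TopologicalSpace EG]
  {EN : Type w₂} [AddCommGroup EN] [Module 𝕜 EN] [TopologicalSpace EN]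
  {G : Type u} [Group G] [TopologicalSpace G] [ChartedSpace EG G]
  {N : Type v} [Group N] [TopologicalSpace N] [ChartedSpace EN N]

/-- The bijection from `N × G` onto the twisted product. -/
def TwistedProduct.equivProd (f : SmoothFactorSystem 𝕜 EG EN G N) : N × G ≃ TwistedProduct f where
  toFun p := ⟨p.1, p.2⟩
  invFun x := (x.fst, x.snd)
  left_inv _ := rfl
  right_inv _ := rfl

/-- Written this way, `ω` enters conjugation by `k` only through the quotient controlled by
`C^2_ss`; neither `ω(g, ·)` nor `ω(·, g)` need be smooth near `1` separately. -/
theorem SmoothFactorSystem.conj_mk (f : SmoothFactorSystem 𝕜 EG EN G N) (k : TwistedProduct f)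
    (n : N) (x : G) :
    k * ⟨n, x⟩ * k⁻¹ = ⟨k.fst * (f.S k.snd n * (f.ω k.snd x *
      (f.ω (k.snd * x * k.snd⁻¹) k.snd)⁻¹)) * f.S (k.snd * x * k.snd⁻¹) k.fst⁻¹,
      k.snd * x * k.snd⁻¹⟩ := by
  rw [mul_inv_eq_iff_eq_mul]
  ext
  · simp [TwistedProduct.mul_def, mul_assoc]
  · simp [TwistedProduct.mul_def]

namespace TwistedLieStructure

variable {f : SmoothFactorSystem 𝕜 EG EN G N} (L : TwistedLieStructure f)

instance : IsMBLieGroup 𝕜 L.Model L.Carrier := L.isLieGroup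

theorem mk'_mul_mk' (n n' : N) (g g' : G) :
    L.mk' n g * L.mk' n' g' = L.mk' (n * f.S g n' * f.ω g g') (g * g') := rfl

theorem incl_apply (n : N) : L.incl n = L.mk' n 1 := rfl

@[simp]
theorem proj_mk' (n : N) (g : G) : L.proj (L.mk' n g) = g := rfl

/-- The component in `N`, as a function on the Lie group. -/
def toN (x : L.Carrier) : N := TwistedProduct.fst x

@[simp]
theorem toN_mk' (n : N) (g : G) : L.toN (L.mk' n g) = n := rfl

theorem mk'_eta (x : L.Carrier) : L.mk' (L.toN x) (L.proj x) = x := rfl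

theorem incl_mul_mk' (n : N) (g : G) : L.incl n * L.mk' 1 g = L.mk' n g := by
  rw [incl_apply, mk'_mul_mk', map_one, mul_one, f.ω_one_left, mul_one, one_mul]

theorem mk'_one_mul_incl (n : N) (g : G) : L.mk' 1 g * L.incl n = L.mk' (f.S g n) g := by
  rw [incl_apply, mk'_mul_mk', one_mul, f.ω_one_right, mul_one, mul_one]

/-- The local inverse provided by `isDiffeoOn` is unspecified, but on the image it can only be the
pair of coordinate functions. -/
theorem exists_nhd : ∃ U : Set G, IsOpen U ∧ 1 ∈ U ∧
    (∀ n, ∀ g ∈ U, ManSmoothAt 𝕜 (EN × EG) L.Model (fun p : N × G => L.mk' p.1 p.2) (n, g)) ∧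
    ∀ n, ∀ g ∈ U, ManSmoothAt 𝕜 L.Model (EN × EG) (fun x => (L.toN x, L.proj x)) (L.mk' n g) := by
  obtain ⟨U, hU, h1, ho, ho', -, hs, F, ⟨hF, -⟩, hs'⟩ := L.isDiffeoOn
  have hs₁ : ManSmoothOn 𝕜 (EN × EG) L.Model (fun p : N × G => L.mk' p.1 p.2) (univ ×ˢ U) := hs
  refine ⟨U, hU, h1, fun n g hg => hs₁.manSmoothAt ho (x := (n, g)) ⟨mem_univ n, hg⟩,
    fun n g hg => ?_⟩
  have ho'' : IsOpen {x : L.Carrier | L.proj x ∈ U} := ho'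
  have hs'' : ManSmoothOn 𝕜 L.Model (EN × EG) (M := L.Carrier) F {x | L.proj x ∈ U} := hs'
  have h2 := hs''.congr ho'' (g := fun x : L.Carrier => (L.toN x, L.proj x)) fun x hx =>
    (hF (x := (L.toN x, L.proj x)) ⟨mem_univ _, hx⟩).symm
  exact h2.manSmoothAt ho'' hg

theorem smoothAt_mk' (n : N) :
    ManSmoothAt 𝕜 (EN × EG) L.Model (fun p : N × G => L.mk' p.1 p.2) (n, 1) :=
  let ⟨_, _, h1, h, _⟩ := L.exists_nhd
  h n 1 h1

theorem smoothAt_coord (n : N) :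
    ManSmoothAt 𝕜 L.Model (EN × EG) (fun x => (L.toN x, L.proj x)) (L.incl n) :=
  let ⟨_, _, h1, _, h⟩ := L.exists_nhd
  h n 1 h1

end TwistedLieStructure

variable [PolynormableSpace 𝕜 EG] [T2Space EG] [PolynormableSpace 𝕜 EN] [T2Space EN]
  [IsMBLieGroup 𝕜 EG G] [IsMBLieGroup 𝕜 EN N]

/-! ### Construction of the Lie group structure -/

namespace SmoothFactorSystem

variable (f : SmoothFactorSystem 𝕜 EG EN G N)

omit [PolynormableSpace 𝕜 EG] [T2Space EG] [PolynormableSpace 𝕜 EN] [T2Space EN]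
  [IsMBLieGroup 𝕜 EN N] in
/-- There is an identity neighborhood `V` such that `ω(g, ·)` is smooth where it maps `V` to
`g⁻¹ V`. -/
theorem exists_smoothAt_ω_left : ∃ V : Set G, IsOpen V ∧ 1 ∈ V ∧
    ∀ g : G, ∀ x ∈ V, g * x ∈ V →
      ManSmoothAt 𝕜 (EG × EG) EN (fun p : G × G => f.ω p.1 p.2) (g, x) := by
  have := IsMBLieGroup.isTopologicalGroup 𝕜 EG G
  obtain ⟨W, hW, h1W, hω⟩ := f.smoothAt_ω
  -- This map sends `(g * x, x)` to `(g, x)`: when `x` and `g * x` are both near `1`, so is `g`, and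
  -- local smoothness of `ω` suffices.
  have h1 : ∀ᶠ p : G × G in 𝓝 1, (p.1 * p.2⁻¹, p.2) ∈ W := by
    have hc : Continuous fun p : G × G => (p.1 * p.2⁻¹, p.2) := by fun_prop
    exact (hc.tendsto' 1 (1, 1) (by simp)).eventually (hW.eventually_mem h1W)
  obtain ⟨V₁, hV₁, V₂, hV₂, hV⟩ := mem_nhds_prod_iff.1 h1
  obtain ⟨V, hVs, hVo, h1V⟩ := mem_nhds_iff.1 (inter_mem hV₁ hV₂)
  refine ⟨V, hVo, h1V, fun g x hx hgx => hω.manSmoothAt hW ?_⟩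
  have h2 : ((g * x, x) : G × G) ∈ V₁ ×ˢ V₂ := ⟨(hVs hgx).1, (hVs hx).2⟩
  simpa using hV h2

/-- The local Lie group data of the twisted product. -/
def localLieData : LocalLieData 𝕜 (EN × EG) (N × G) (TwistedProduct f) where
  equiv := TwistedProduct.equivProd f
  nhd := univ ×ˢ f.exists_smoothAt_ω_left.choose
  isOpen_nhd := isOpen_univ.prod f.exists_smoothAt_ω_left.choose_spec.1
  one_mem := ⟨mem_univ _, f.exists_smoothAt_ω_left.choose_spec.2.1⟩
  smooth_left k := by
    refine .of_locally fun p hp => ?_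
    have hid := manSmoothAt_id (𝕜 := 𝕜) (E := EN × EG) p
    have h1 := ManSmoothAt.comp (g := fun p : G × G => f.ω p.1 p.2) p
      (f.exists_smoothAt_ω_left.choose_spec.2.2 k.snd p.2 hp.1.2 hp.2.2)
      ((manSmoothAt_const k.snd p).prodMk hid.snd)
    exact (((manSmoothAt_const k.fst p).mul (f.smoothAt_S_apply_comp k.snd hid.fst)).mul h1).prodMk
      ((manSmoothAt_const k.snd p).mul hid.snd)
  isOpen_left k := by
    have := IsMBLieGroup.isTopologicalGroup 𝕜 EG G
    have h := f.exists_smoothAt_ω_left.choose_spec.1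
    have hc : Continuous fun p : N × G => k.snd * p.2 := by fun_prop
    refine (congrArg IsOpen (Set.ext fun p => ?_)).mpr
      ((isOpen_univ.prod h).inter (h.preimage hc))
    exact ⟨fun hp => ⟨hp.1, hp.2.2⟩, fun hp => ⟨hp.1, mem_univ _, hp.2⟩⟩
  smooth_mul := by
    have hid := manSmoothAt_id (𝕜 := 𝕜) (E := (EN × EG) × (EN × EG))
      (((1, 1), (1, 1)) : (N × G) × (N × G))
    exact ((hid.fst.fst.mul (f.smoothAt_S_comp hid.fst.snd hid.snd.fst rfl)).mul
      (f.smoothAt_ω_comp hid.fst.snd hid.snd.snd rfl rfl)).prodMk (hid.fst.snd.mul hid.snd.snd)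
  smooth_inv := by
    have hid := manSmoothAt_id (𝕜 := 𝕜) (E := EN × EG) ((1, 1) : N × G)
    exact ((f.smoothAt_ω_comp hid.snd.inv hid.snd inv_one rfl).inv.mul
      (f.smoothAt_S_comp hid.snd.inv hid.fst.inv inv_one)).prodMk hid.snd.inv
  smooth_conj k := by
    have hid := manSmoothAt_id (𝕜 := 𝕜) (E := EN × EG) ((1, 1) : N × G)
    have hc : ManSmoothAt 𝕜 (EN × EG) EG (fun p : N × G => k.snd * p.2 * k.snd⁻¹) (1, 1) :=
      ((manSmoothAt_const _ _).mul hid.snd).mul (manSmoothAt_const _ _)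
    have h1 := ManSmoothAt.comp (g := fun x => f.ω k.snd x * (f.ω (k.snd * x * k.snd⁻¹) k.snd)⁻¹)
      ((1, 1) : N × G) (f.smoothAt_ω_conj k.snd) hid.snd
    have h2 := f.smoothAt_S_comp hc (manSmoothAt_const k.fst⁻¹ _) (by simp)
    have h3 := (((manSmoothAt_const k.fst _).mul
      ((f.smoothAt_S_apply_comp k.snd hid.fst).mul h1)).mul h2).prodMk hc
    refine h3.congr (.of_forall fun p => ?_)
    exact congrArg (TwistedProduct.equivProd f).symm (f.conj_mk k p.1 p.2)

/-- The Lie group structure on the twisted product. -/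
def twistedLieStructure : TwistedLieStructure f where
  Model := EN × EG
  top := inferInstanceAs (TopologicalSpace f.localLieData.Space)
  charted := inferInstanceAs (ChartedSpace (EN × EG) f.localLieData.Space)
  isLieGroup := inferInstanceAs (IsMBLieGroup 𝕜 (EN × EG) f.localLieData.Space)
  isDiffeoOn := by
    refine ⟨_, f.exists_smoothAt_ω_left.choose_spec.1, f.exists_smoothAt_ω_left.choose_spec.2.1, ?_⟩
    have h1 := f.localLieData.isDiffeoOn_spaceEquiv
    have h2 : {x : TwistedProduct f | x.snd ∈ f.exists_smoothAt_ω_left.choose} =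
        f.localLieData.spaceEquiv.symm ⁻¹' f.localLieData.nhd := by
      ext x
      exact ⟨fun h => ⟨mem_univ _, h⟩, fun h => h.2⟩
    rw [h2]
    exact h1

end SmoothFactorSystem

/-! ### Uniqueness of the structure and local triviality -/

namespace TwistedLieStructure

variable {f : SmoothFactorSystem 𝕜 EG EN G N} (L : TwistedLieStructure f)

omit [T2Space EG] [T2Space EN] [IsMBLieGroup 𝕜 EG G] [IsMBLieGroup 𝕜 EN N] in
/-- A homomorphism on the twisted product is smooth if it is smooth near `(1, 1)` as a map on
`N × G`. -/
theorem hom_smooth {E : Type w₃} [AddCommGroup E] [Module 𝕜 E] [TopologicalSpace E]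
    [PolynormableSpace 𝕜 E] [T2Space E] {H : Type u'} [Group H] [TopologicalSpace H]
    [ChartedSpace E H] [IsMBLieGroup 𝕜 E H] (φ : L.Carrier →* H)
    (h : ManSmoothAt 𝕜 (EN × EG) E (fun p : N × G => φ (L.mk' p.1 p.2)) (1, 1)) :
    ManSmoothOn 𝕜 L.Model E φ univ := by
  refine φ.manSmoothOn_of_manSmoothAt_one ?_
  exact ManSmoothAt.comp (g := fun p : N × G => φ (L.mk' p.1 p.2)) _ h
    (f := fun x : L.Carrier => (L.toN x, L.proj x)) (L.smoothAt_coord 1)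

omit [T2Space EG] [T2Space EN] [IsMBLieGroup 𝕜 EG G] [IsMBLieGroup 𝕜 EN N] in
theorem isDiffeoOn_id (L' : TwistedLieStructure f) : IsDiffeoOn 𝕜 L.Model L'.Model
    (fun x : L.Carrier => L'.mk' x.fst x.snd) univ univ := by
  -- Both structures have the product structure near `1`, so the identity homomorphism is smooth
  -- near `1` in both directions, hence everywhere.
  let φ : L.Carrier →* L'.Carrier := MonoidHom.id (TwistedProduct f)
  let ψ : L'.Carrier →* L.Carrier := MonoidHom.id (TwistedProduct f)
  exact ⟨isOpen_univ, isOpen_univ, bijOn_univ.2 Function.bijective_id,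
    L.hom_smooth φ (L'.smoothAt_mk' 1), ψ, ⟨fun _ _ => rfl, fun _ _ => rfl⟩,
    L'.hom_smooth ψ (L.smoothAt_mk' 1)⟩

omit [T2Space EG] [T2Space EN] [IsMBLieGroup 𝕜 EG G] in
theorem smooth_incl : ManSmoothOn 𝕜 EN L.Model L.incl univ := by
  refine .of_locally fun n _ => ?_
  exact ManSmoothAt.comp (g := fun p : N × G => L.mk' p.1 p.2) n (L.smoothAt_mk' n)
    ((manSmoothAt_id n).prodMk (manSmoothAt_const 1 n))

omit [T2Space EN] in
theorem smooth_proj : ManSmoothOn 𝕜 L.Model EG L.proj univ :=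
  L.hom_smooth L.proj (manSmoothAt_id (𝕜 := 𝕜) (E := EN × EG) ((1, 1) : N × G)).snd

theorem isExtension : L.IsExtension where
  isLieGroup := L.isLieGroup
  smooth_incl := L.smooth_incl
  smooth_proj := L.smooth_proj
  injective n n' h := congrArg L.toN h
  surjective g := ⟨L.mk' 1 g, rfl⟩
  exact := by
    ext x
    rw [MonoidHom.mem_range, MonoidHom.mem_ker]
    constructor
    · rintro ⟨n, rfl⟩
      rfl
    · intro hx
      exact ⟨L.toN x, by rw [incl_apply, ← hx, mk'_eta]⟩
  locallyTrivial g := by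
    have := IsMBLieGroup.isTopologicalGroup 𝕜 EG G
    obtain ⟨U₀, hU₀, h1, hs, -⟩ := L.exists_nhd
    -- The obvious section `x ↦ (1, x)` is only known to be smooth near `1`; near `g` its translate
    -- by `(1, g)` is used instead.
    let σ : G → L.Carrier := fun x => L.mk' 1 g * L.mk' 1 (g⁻¹ * x)
    have hU : IsOpen {x | g⁻¹ * x ∈ U₀} := hU₀.preimage (continuous_const_mul g⁻¹)
    have hσ : ∀ x, L.proj (σ x) = x := fun x => by simp [σ]
    have hσs : ∀ x, g⁻¹ * x ∈ U₀ → ManSmoothAt 𝕜 EG L.Model σ x := fun x hx =>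
      (manSmoothAt_const _ _).mul (ManSmoothAt.comp (g := fun p : N × G => L.mk' p.1 p.2)
        (f := fun x => ((1 : N), g⁻¹ * x)) x (hs 1 _ hx) ((manSmoothAt_const 1 x).prodMk
          ((manSmoothAt_const _ _).mul (manSmoothAt_id x))))
    have hproj : Continuous L.proj := continuousOn_univ.1 L.smooth_proj.1
    have hker : ∀ y : L.Carrier, (σ (L.proj y))⁻¹ * y = L.incl (L.toN ((σ (L.proj y))⁻¹ * y)) := by
      intro y
      have h : L.proj ((σ (L.proj y))⁻¹ * y) = 1 := by simp [hσ]
      rw [incl_apply, ← h, mk'_eta]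
    refine ⟨{x | g⁻¹ * x ∈ U₀}, hU, by simpa using h1, σ, .of_locally hσs, fun x _ => hσ x,
      hU.prod isOpen_univ, hU.preimage hproj, ⟨?_, ?_, ?_⟩, ?_,
      fun y => (L.proj y, L.toN ((σ (L.proj y))⁻¹ * y)), ⟨?_, ?_⟩, ?_⟩
    · rintro ⟨x, n⟩ hx
      have : L.proj (σ x * L.incl n) = x := by simp [hσ, incl_apply]
      simpa [this] using hx.1
    · rintro ⟨x, n⟩ - ⟨x', n'⟩ - h
      have hx := congrArg L.proj h
      simp only [map_mul, hσ, incl_apply, proj_mk', mul_one] at hx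
      subst hx
      exact congrArg (Prod.mk x) (congrArg L.toN (mul_left_cancel h))
    · intro y hy
      refine ⟨(L.proj y, L.toN ((σ (L.proj y))⁻¹ * y)), ⟨hy, mem_univ _⟩, ?_⟩
      simp only
      rw [← hker, mul_inv_cancel_left]
    · refine .of_locally fun p hp => ?_
      have hid := manSmoothAt_id (𝕜 := 𝕜) (E := EG × EN) p
      exact (ManSmoothAt.comp (g := σ) p (hσs p.1 hp.1) hid.fst).mul
        (ManSmoothAt.comp (g := L.incl) p (L.smooth_incl.manSmoothAt isOpen_univ (mem_univ _))
          hid.snd)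
    · rintro ⟨x, n⟩ -
      have : L.proj (σ x * L.incl n) = x := by simp [hσ, incl_apply]
      simp only [this, inv_mul_cancel_left]
      rfl
    · intro y _
      simp only
      rw [← hker, mul_inv_cancel_left]
    · refine .of_locally fun y hy => ?_
      have hp : ManSmoothAt 𝕜 L.Model EG L.proj y :=
        L.smooth_proj.manSmoothAt isOpen_univ (mem_univ _)
      have h2 := (ManSmoothAt.comp (g := σ) y (hσs _ hy) hp).inv.mul (manSmoothAt_id y)
      refine hp.prodMk (ManSmoothAt.comp (g := L.toN) y ?_ h2)
      rw [hker]
      exact (L.smoothAt_coord _).fst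

end TwistedLieStructure

end Twisted

/-! ### Factor systems of extensions -/

section Extension

variable {𝕜 : Type w} [RCLike 𝕜]
  {EG : Type w₁} [AddCommGroup EG] [Module 𝕜 EG] [TopologicalSpace EG]
  {EN : Type w₂} [AddCommGroup EN] [Module 𝕜 EN] [TopologicalSpace EN]
  {G : Type u} [Group G] [TopologicalSpace G] [ChartedSpace EG G]
  {N : Type v} [Group N] [TopologicalSpace N] [ChartedSpace EN N]
  {E : Type w₃} [AddCommGroup E] [Module 𝕜 E] [TopologicalSpace E]
  {Ghat : Type u'} [Group Ghat] [TopologicalSpace Ghat] [ChartedSpace E Ghat]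
  {ι : N →* Ghat} {q : Ghat →* G}

namespace IsLieGroupExtension

theorem proj_incl (hX : IsLieGroupExtension 𝕜 EG EN E ι q) (n : N) : q (ι n) = 1 := by
  have h : ι n ∈ q.ker := hX.exact ▸ ⟨n, rfl⟩
  exact h

theorem exists_incl_eq (hX : IsLieGroupExtension 𝕜 EG EN E ι q) {y : Ghat} (hy : q y = 1) :
    ∃ n, ι n = y := by
  have h : y ∈ ι.range := hX.exact ▸ hy
  exact h

theorem smoothAt_incl (hX : IsLieGroupExtension 𝕜 EG EN E ι q) (n : N) :
    ManSmoothAt 𝕜 EN E ι n := hX.smooth_incl.manSmoothAt isOpen_univ (mem_univ n)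

theorem smoothAt_proj (hX : IsLieGroupExtension 𝕜 EG EN E ι q) (y : Ghat) :
    ManSmoothAt 𝕜 E EG q y := hX.smooth_proj.manSmoothAt isOpen_univ (mem_univ y)

variable [PolynormableSpace 𝕜 EG] [PolynormableSpace 𝕜 E] [T2Space E]

/-- The inclusion of `N` has a left inverse that is smooth near `N`. -/
theorem exists_retraction [T2Space EG] [PolynormableSpace 𝕜 EN] [T2Space EN] [IsMBLieGroup 𝕜 EN N]
    (hX : IsLieGroupExtension 𝕜 EG EN E ι q) :
    ∃ r : Ghat → N, (∀ n, r (ι n) = n) ∧ ∀ n, ManSmoothAt 𝕜 E EN r (ι n) := by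
  have := hX.isLieGroup
  obtain ⟨U, hU, h1, σ, -, hσ, -, ho, -, -, T, ⟨hT, -⟩, hTs⟩ := hX.locallyTrivial 1
  have hT1 : ∀ n, T (σ 1 * ι n) = (1, n) := fun n => hT (x := (1, n)) ⟨h1, mem_univ n⟩
  -- The section `σ` need not be normalized, so `ι n` is first moved to `σ 1 * ι n`, which has
  -- coordinates `(1, n)` in the trivialization.
  refine ⟨fun y => (T (σ 1 * y)).2, fun n => by simp only [hT1], fun n => ?_⟩
  refine ManSmoothAt.snd (ManSmoothAt.comp (g := T) _ (hTs.manSmoothAt ho ?_)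
    ((manSmoothAt_const (σ 1) _).mul (manSmoothAt_id _)))
  rw [mem_preimage, map_mul, hσ 1 h1, hX.proj_incl, mul_one]
  exact h1

/-- The projection has a normalized section that is smooth near `1`. -/
theorem exists_section (hX : IsLieGroupExtension 𝕜 EG EN E ι q) :
    ∃ σ : G → Ghat, (∀ x, q (σ x) = x) ∧ σ 1 = 1 ∧ ManSmoothAt 𝕜 EG E σ 1 := by
  have := hX.isLieGroup
  classical
  obtain ⟨U, hU, h1, σ, hσs, hσ, -⟩ := hX.locallyTrivial 1
  choose τ hτ using hX.surjective
  -- Since `σ 1` lies over `1`, the right factor normalizes `σ` without leaving the fibers. Outside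
  -- `U` any set-theoretic section will do.
  refine ⟨fun x => if x ∈ U then σ x * (σ 1)⁻¹ else τ x, fun x => ?_, by simp [h1], ?_⟩
  · by_cases hx : x ∈ U
    · simp [hx, hσ x hx, hσ 1 h1]
    · simp [hx, hτ]
  · refine ((hσs.manSmoothAt hU h1).mul (manSmoothAt_const (σ 1)⁻¹ 1)).congr ?_
    filter_upwards [hU.mem_nhds h1] with x hx
    simp [hx]

end IsLieGroupExtension

/-- Equivalences of extensions are invertible. -/
theorem IsExtEquivalence.exists_symm [PolynormableSpace 𝕜 EG] [T2Space EG]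
    [PolynormableSpace 𝕜 EN] [T2Space EN] [IsMBLieGroup 𝕜 EN N] [PolynormableSpace 𝕜 E] [T2Space E]
    {E' : Type w₄} [AddCommGroup E'] [Module 𝕜 E'] [TopologicalSpace E'] [PolynormableSpace 𝕜 E']
    [T2Space E'] {Ghat' : Type v'} [Group Ghat'] [TopologicalSpace Ghat'] [ChartedSpace E' Ghat']
    {ι' : N →* Ghat'} {q' : Ghat' →* G}
    (hX : IsLieGroupExtension 𝕜 EG EN E ι q) (hY : IsLieGroupExtension 𝕜 EG EN E' ι' q')
    {φ : Ghat →* Ghat'} (hφ : IsExtEquivalence 𝕜 E E' ι q ι' q' φ) :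
    ∃ ψ : Ghat' →* Ghat, IsExtEquivalence 𝕜 E' E ι' q' ι q ψ := by
  have := hX.isLieGroup
  have := hY.isLieGroup
  obtain ⟨r, hr, hrs⟩ := hY.exists_retraction
  obtain ⟨σ, hσ, hσ1, hσs⟩ := hX.exists_section
  have hinj : Function.Injective φ := by
    rw [injective_iff_map_eq_one]
    intro x hx
    obtain ⟨n, rfl⟩ := hX.exists_incl_eq (y := x) (by rw [← hφ.proj_comp, hx, map_one])
    rw [hφ.comp_incl] at hx
    rw [(injective_iff_map_eq_one ι').1 hY.injective n hx, map_one]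
  -- An explicit inverse of `φ`: `y` differs from `φ (σ (q' y))` by some `ι' n`, which `φ` hits at
  -- `ι n`, and `r` reads off `n`. Every ingredient is smooth at the relevant point when `y` is near
  -- `1`.
  let θ : Ghat' → Ghat := fun y => σ (q' y) * ι (r ((φ (σ (q' y)))⁻¹ * y))
  have hθ : ∀ y, φ (θ y) = y := by
    intro y
    obtain ⟨n, hn⟩ := hY.exists_incl_eq (y := (φ (σ (q' y)))⁻¹ * y) (by
      rw [map_mul, map_inv, hφ.proj_comp, hσ, inv_mul_cancel])
    simp only [θ, map_mul, hφ.comp_incl]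
    rw [← hn, hr, hn, mul_inv_cancel_left]
  let e := MulEquiv.ofBijective φ ⟨hinj, fun y => ⟨θ y, hθ y⟩⟩
  have he : ∀ y, e.symm y = θ y := fun y => (MulEquiv.symm_apply_eq e).2 (hθ y).symm
  refine ⟨e.symm, MonoidHom.manSmoothOn_of_manSmoothAt_one _ ?_, fun n => ?_, fun y => ?_⟩
  · have h1 : ManSmoothAt 𝕜 E' E (fun y => σ (q' y)) (1 : Ghat') :=
      .comp (g := σ) _ (by rw [map_one]; exact hσs) (hY.smoothAt_proj 1)
    have h2 : ManSmoothAt 𝕜 E' E' (fun y => (φ (σ (q' y)))⁻¹ * y) (1 : Ghat') :=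
      (ManSmoothAt.comp (g := φ) _ (hφ.smooth.manSmoothAt isOpen_univ (mem_univ _)) h1).inv.mul
        (manSmoothAt_id _)
    have h3 : ManSmoothAt 𝕜 E' EN (fun y => r ((φ (σ (q' y)))⁻¹ * y)) (1 : Ghat') :=
      .comp (g := r) _ (by simpa [hσ1] using hrs 1) h2
    exact (h1.mul (ManSmoothAt.comp (g := ι) _ (hX.smoothAt_incl _) h3)).congr (.of_forall he)
  · exact (MulEquiv.symm_apply_eq e).2 (hφ.comp_incl n).symm
  · change q (e.symm y) = _
    rw [he, ← hφ.proj_comp, hθ]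

/-! ### The factor system of a normalized section -/

namespace IsLieGroupExtension

/-- On the kernel of `q` the retraction inverts `ι`. Identities in `N` between values of `r` can
thus be checked in `Ghat` after applying the injective `ι`. -/
theorem incl_retraction (hX : IsLieGroupExtension 𝕜 EG EN E ι q) {r : Ghat → N}
    (hr : ∀ n, r (ι n) = n) {y : Ghat} (hy : q y = 1) : ι (r y) = y := by
  obtain ⟨n, rfl⟩ := hX.exists_incl_eq hy
  rw [hr]

theorem proj_conj (hX : IsLieGroupExtension 𝕜 EG EN E ι q) (x : Ghat) (n : N) :
    q (x * ι n * x⁻¹) = 1 := by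
  simp [hX.proj_incl]

theorem incl_retraction_conj (hX : IsLieGroupExtension 𝕜 EG EN E ι q) {r : Ghat → N}
    (hr : ∀ n, r (ι n) = n) (x : Ghat) (n : N) : ι (r (x * ι n * x⁻¹)) = x * ι n * x⁻¹ :=
  hX.incl_retraction hr (hX.proj_conj x n)

/-- The conjugation with `x`, as an automorphism of `N`. -/
def conjAut (hX : IsLieGroupExtension 𝕜 EG EN E ι q) {r : Ghat → N} (hr : ∀ n, r (ι n) = n)
    (x : Ghat) : MulAut N where
  toFun n := r (x * ι n * x⁻¹)
  invFun n := r (x⁻¹ * ι n * x⁻¹⁻¹)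
  left_inv n := hX.injective (by simp only [hX.incl_retraction_conj hr]; group; rw [hr])
  right_inv n := hX.injective (by simp only [hX.incl_retraction_conj hr]; group; rw [hr])
  map_mul' n n' := hX.injective (by
    rw [hX.incl_retraction_conj hr, map_mul, map_mul, hX.incl_retraction_conj hr,
      hX.incl_retraction_conj hr]
    group)

theorem incl_conjAut (hX : IsLieGroupExtension 𝕜 EG EN E ι q) {r : Ghat → N}
    (hr : ∀ n, r (ι n) = n) (x : Ghat) (n : N) : ι (hX.conjAut hr x n) = x * ι n * x⁻¹ :=
  hX.incl_retraction_conj hr x n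

variable [PolynormableSpace 𝕜 EG] [T2Space EG] [PolynormableSpace 𝕜 EN] [T2Space EN]
  [IsMBLieGroup 𝕜 EG G] [IsMBLieGroup 𝕜 EN N] [PolynormableSpace 𝕜 E] [T2Space E]

omit [PolynormableSpace 𝕜 EG] [T2Space EG] [IsMBLieGroup 𝕜 EG G] [IsMBLieGroup 𝕜 EN N] in
theorem isLieAut_conjAut (hX : IsLieGroupExtension 𝕜 EG EN E ι q) {r : Ghat → N}
    (hr : ∀ n, r (ι n) = n) (hrs : ∀ n, ManSmoothAt 𝕜 E EN r (ι n)) (x : Ghat) :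
    IsLieAut 𝕜 EN (hX.conjAut hr x) := by
  have := hX.isLieGroup
  have key : ∀ x : Ghat, ManSmoothOn 𝕜 EN EN (fun n => r (x * ι n * x⁻¹)) univ := fun x =>
    .of_locally fun n _ => .comp (g := r) _
      (by rw [← hX.incl_retraction_conj hr]; exact hrs _)
      (((manSmoothAt_const x n).mul (hX.smoothAt_incl n)).mul (manSmoothAt_const x⁻¹ n))
  exact ⟨key x, key x⁻¹⟩

/-- The factor system defined by a normalized section. -/
def factorSystem (hX : IsLieGroupExtension 𝕜 EG EN E ι q) {r : Ghat → N}
    (hr : ∀ n, r (ι n) = n) (hrs : ∀ n, ManSmoothAt 𝕜 E EN r (ι n)) {σ : G → Ghat}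
    (hσ : ∀ x, q (σ x) = x) (hσ1 : σ 1 = 1) (hσs : ManSmoothAt 𝕜 EG E σ 1) :
    SmoothFactorSystem 𝕜 EG EN G N where
  S g := hX.conjAut hr (σ g)
  ω g g' := r (σ g * σ g' * (σ (g * g'))⁻¹)
  isC1sAut := by
    have := hX.isLieGroup
    obtain ⟨U, hU, h1, hσU⟩ := hσs
    refine isC1sAut_of (fun g => hX.isLieAut_conjAut hr hrs _) ?_ hU h1 fun g hg n => ?_
    · ext n
      exact hX.injective (by simp [incl_conjAut, hσ1])
    · have hid := manSmoothAt_id (𝕜 := 𝕜) (E := EG × EN) (g, n)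
      have h2 := ManSmoothAt.comp (g := σ) _ (hσU.manSmoothAt hU hg) hid.fst
      refine .comp (g := r) (f := fun p : G × N => σ p.1 * ι p.2 * (σ p.1)⁻¹) _ ?_
        ((h2.mul (ManSmoothAt.comp (g := ι) _ (hX.smoothAt_incl n) hid.snd)).mul h2.inv)
      have h3 := hrs (r (σ g * ι n * (σ g)⁻¹))
      rwa [hX.incl_retraction_conj hr] at h3
  isC2ss := by
    have := hX.isLieGroup
    have hr1 : r 1 = 1 := by simpa using hr 1
    have hrs1 : ManSmoothAt 𝕜 E EN r 1 := by simpa using hrs 1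
    refine ⟨⟨?_, fun g => by simp [hσ1, hr1]⟩, fun g => ?_⟩
    · have hid := manSmoothAt_id (𝕜 := 𝕜) (E := EG × EG) ((1, 1) : G × G)
      exact ManSmoothAt.comp (g := r) ((1, 1) : G × G) (by simpa [hσ1] using hrs1)
        (((ManSmoothAt.comp (g := σ) ((1, 1) : G × G) hσs hid.fst).mul
          (ManSmoothAt.comp (g := σ) ((1, 1) : G × G) hσs hid.snd)).mul
          (ManSmoothAt.comp (g := σ) ((1, 1) : G × G) (by simpa using hσs)
            (hid.fst.mul hid.snd)).inv)
    · have hid := manSmoothAt_id (𝕜 := 𝕜) (E := EG) (1 : G)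
      -- After applying `ι`, the quotient `ω(g, x) ω(g x g⁻¹, g)⁻¹` becomes this product: the values
      -- `σ (g * x)`, about which nothing is known away from `1`, cancel.
      have h1 : ManSmoothAt 𝕜 EG E
          (fun x => σ g * σ x * (σ g)⁻¹ * (σ (g * x * g⁻¹))⁻¹) (1 : G) :=
        (((manSmoothAt_const (σ g) _).mul hσs).mul (manSmoothAt_const (σ g)⁻¹ _)).mul
          (ManSmoothAt.comp (g := σ) _ (by simpa using hσs)
            (((manSmoothAt_const g _).mul hid).mul (manSmoothAt_const g⁻¹ _))).inv
      refine (ManSmoothAt.comp (g := r) _ (by simpa [hσ1] using hrs1) h1).congr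
        (.of_forall fun x => hX.injective ?_)
      simp only [map_mul, map_inv]
      rw [hX.incl_retraction hr (by simp [hσ]), hX.incl_retraction hr (by simp [hσ]),
        hX.incl_retraction hr (by simp [hσ])]
      simp [mul_assoc]
  delta_eq g g' := by
    rw [mul_inv_eq_iff_eq_mul]
    ext n
    refine hX.injective ?_
    simp only [MulAut.mul_apply, MulAut.conj_apply, map_mul, map_inv, incl_conjAut]
    rw [hX.incl_retraction hr (by simp [hσ])]
    group
  d_eq_one g g' g'' := by
    refine hX.injective ?_
    simp only [map_mul, map_inv, incl_conjAut, map_one]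
    rw [hX.incl_retraction hr (by simp [hσ]), hX.incl_retraction hr (by simp [hσ, mul_assoc]),
      hX.incl_retraction hr (by simp [hσ]), hX.incl_retraction hr (by simp [hσ])]
    simp [mul_assoc]

/-- Every extension is equivalent to one that is defined by a smooth factor system. -/
theorem exists_factorSystem (hX : IsLieGroupExtension 𝕜 EG EN E ι q) :
    ∃ f : SmoothFactorSystem 𝕜 EG EN G N, ∀ L : TwistedLieStructure f,
      ∃ φ : L.Carrier →* Ghat, IsExtEquivalence 𝕜 L.Model E L.incl L.proj ι q φ := by
  have := hX.isLieGroup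
  obtain ⟨r, hr, hrs⟩ := hX.exists_retraction
  obtain ⟨σ, hσ, hσ1, hσs⟩ := hX.exists_section
  refine ⟨hX.factorSystem hr hrs hσ hσ1 hσs, fun L => ?_⟩
  let φ : L.Carrier →* Ghat := MonoidHom.mk' (fun x => ι (L.toN x) * σ (L.proj x)) (by
    intro x y
    change ι (L.toN x * hX.conjAut hr (σ (L.proj x)) (L.toN y) *
      r (σ (L.proj x) * σ (L.proj y) * (σ (L.proj x * L.proj y))⁻¹)) *
      σ (L.proj x * L.proj y) = _
    rw [map_mul, map_mul, incl_conjAut, hX.incl_retraction hr (by simp [hσ])]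
    group)
  refine ⟨φ, L.hom_smooth φ ?_, fun n => ?_, fun x => ?_⟩
  · have hid := manSmoothAt_id (𝕜 := 𝕜) (E := EN × EG) ((1, 1) : N × G)
    exact (ManSmoothAt.comp (g := ι) ((1, 1) : N × G) (hX.smoothAt_incl _) hid.fst).mul
      (ManSmoothAt.comp (g := σ) ((1, 1) : N × G) hσs hid.snd)
  · change ι n * σ 1 = ι n
    rw [hσ1, mul_one]
  · change q (ι (L.toN x) * σ (L.proj x)) = L.proj x
    rw [map_mul, hX.proj_incl, one_mul, hσ]

end IsLieGroupExtension

end Extension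

/-! ### Equivalences of extensions defined by factor systems -/

section Equivalences

variable {𝕜 : Type w} [RCLike 𝕜]
  {EG : Type w₁} [AddCommGroup EG] [Module 𝕜 EG] [TopologicalSpace EG]
  {EN : Type w₂} [AddCommGroup EN] [Module 𝕜 EN] [TopologicalSpace EN]
  {G : Type u} [Group G] [TopologicalSpace G] [ChartedSpace EG G]
  {N : Type v} [Group N] [TopologicalSpace N] [ChartedSpace EN N]
  [PolynormableSpace 𝕜 EG] [T2Space EG] [PolynormableSpace 𝕜 EN] [T2Space EN]
  [IsMBLieGroup 𝕜 EG G] [IsMBLieGroup 𝕜 EN N]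

namespace TwistedLieStructure

variable {f f' : SmoothFactorSystem 𝕜 EG EN G N} (L : TwistedLieStructure f)
  (L' : TwistedLieStructure f')

/-- Equivalences have the form `(n, g) ↦ (n h(g), g)`. -/
theorem exists_of_isEquivalence {φ : L'.Carrier →* L.Carrier} (hφ : L'.IsEquivalence L φ) :
    ∃ h : G → N, IsC1s 𝕜 EG EN h ∧ f'.S = actS h f.S ∧ f'.ω = actOmega h f.S f.ω ∧
      ∀ (n : N) (g : G), φ (L'.mk' n g) = L.mk' (n * h g) g := by
  let h : G → N := fun g => L.toN (φ (L'.mk' 1 g))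
  have h1 : ∀ g, φ (L'.mk' 1 g) = L.mk' (h g) g := fun g => by
    have h2 := hφ.proj_comp (L'.mk' 1 g)
    rw [proj_mk'] at h2
    rw [← L.mk'_eta (φ (L'.mk' 1 g)), h2]
  have h2 : ∀ n g, φ (L'.mk' n g) = L.mk' (n * h g) g := fun n g => by
    rw [← incl_mul_mk', map_mul, hφ.comp_incl, h1, incl_apply, mk'_mul_mk', f.S_one,
      f.ω_one_left, one_mul, mul_one]
    rfl
  -- Obtained by computing `φ` on `(1, g)(n, 1) = (S'(g)(n), g)` in two ways; the product `(1, g)(1,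
  -- g')` gives the formula for `ω'` below.
  have h3 : ∀ g n, f'.S g n * h g = h g * f.S g n := fun g n => by
    have h4 := congrArg φ (L'.mk'_one_mul_incl n g)
    rw [map_mul, hφ.comp_incl, h1, h2, incl_apply, mk'_mul_mk', f.ω_one_right, mul_one,
      mul_one] at h4
    exact (congrArg L.toN h4).symm
  have h4 : f'.S = actS h f.S := by
    ext g n
    exact eq_mul_inv_of_mul_eq (h3 g n)
  refine ⟨h, ⟨?_, ?_⟩, h4, ?_, h2⟩
  · have h5 := L'.smoothAt_mk' 1
    have h6 := ManSmoothAt.comp (g := fun p : N × G => L'.mk' p.1 p.2) (f := fun g => ((1 : N), g))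
      (1 : G) h5 ((manSmoothAt_const _ _).prodMk (manSmoothAt_id (𝕜 := 𝕜) (E := EG) _))
    have h7 := ManSmoothAt.comp (g := φ) _ (hφ.smooth.manSmoothAt isOpen_univ (mem_univ _)) h6
    have h8 : φ (L'.mk' 1 1) = L.incl 1 := hφ.comp_incl 1
    exact (ManSmoothAt.comp (g := fun x => (L.toN x, L.proj x)) _
      (h8 ▸ L.smoothAt_coord 1) h7).fst
  · exact congrArg L.toN (hφ.comp_incl 1)
  · ext g g'
    have h5 := congrArg φ (L'.mk'_mul_mk' 1 1 g g')
    rw [map_mul, h1, h1, h2, mk'_mul_mk', map_one, one_mul, one_mul] at h5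
    exact eq_mul_inv_of_mul_eq (congrArg L.toN h5).symm

/-- The map `(n, g) ↦ (n h(g), g)` is an equivalence of extensions. -/
theorem exists_isEquivalence {h : G → N} (hh : IsC1s 𝕜 EG EN h) (hS : f'.S = actS h f.S)
    (hω : f'.ω = actOmega h f.S f.ω) :
    ∃ φ : L'.Carrier →* L.Carrier, L'.IsEquivalence L φ ∧
      ∀ (n : N) (g : G), φ (L'.mk' n g) = L.mk' (n * h g) g := by
  let φ : L'.Carrier →* L.Carrier := MonoidHom.mk' (fun x => L.mk' (L'.toN x * h (L'.proj x))
    (L'.proj x)) (by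
      intro x y
      rw [← L'.mk'_eta x, ← L'.mk'_eta y, mk'_mul_mk', mk'_mul_mk', hS, hω]
      simp [actS, actOmega, mul_assoc])
  refine ⟨φ, ⟨L'.hom_smooth φ ?_, fun n => ?_, fun x => rfl⟩, fun n g => rfl⟩
  · have hid := manSmoothAt_id (𝕜 := 𝕜) (E := EN × EG) ((1, 1) : N × G)
    refine ManSmoothAt.comp (g := fun p : N × G => L.mk' p.1 p.2)
      (f := fun p : N × G => (p.1 * h p.2, p.2)) _ ?_
      ((hid.fst.mul (hh.smoothAt_comp hid.snd rfl)).prodMk hid.snd)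
    exact L.smoothAt_mk' _
  · change L.mk' (n * h 1) 1 = L.mk' n 1
    rw [hh.2, mul_one]

end TwistedLieStructure

omit [IsMBLieGroup 𝕜 EG G] in
/-- The existence of an equivalence is an equivalence relation on extensions. -/
theorem LieExtension.equivalence_equivalent :
    Equivalence (LieExtension.Equivalent (𝕜 := 𝕜) (EG := EG) (EN := EN) (G := G) (N := N)) where
  refl X := by
    have := X.isExtension.isLieGroup
    exact ⟨MonoidHom.id _, manSmoothOn_id univ, fun _ => rfl, fun _ => rfl⟩
  symm := by
    rintro X Y ⟨φ, hφ⟩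
    exact hφ.exists_symm X.isExtension Y.isExtension
  trans := by
    rintro X Y Z ⟨φ, hφ⟩ ⟨ψ, hψ⟩
    exact ⟨ψ.comp φ, hψ.smooth.comp hφ.smooth isOpen_univ isOpen_univ (mapsTo_univ _ _),
      fun n => by rw [MonoidHom.comp_apply, hφ.comp_incl, hψ.comp_incl],
      fun x => by rw [MonoidHom.comp_apply, hψ.proj_comp, hφ.proj_comp]⟩

end Equivalences

/-! ### The classification theorem -/

theorem mainTheorem4 {𝕜 : Type w} [RCLike 𝕜]
    {EG : Type w₁} [AddCommGroup EG] [Module 𝕜 EG] [TopologicalSpace EG]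
    [PolynormableSpace 𝕜 EG] [T2Space EG]
    {EN : Type w₂} [AddCommGroup EN] [Module 𝕜 EN] [TopologicalSpace EN]
    [PolynormableSpace 𝕜 EN] [T2Space EN]
    {G : Type u} [Group G] [TopologicalSpace G] [ChartedSpace EG G] [IsMBLieGroup 𝕜 EG G]
    {N : Type v} [Group N] [TopologicalSpace N] [ChartedSpace EN N] [IsMBLieGroup 𝕜 EN N] :
    -- every `N ×_f G` carries a Lie group structure as described, it is unique,
    -- and it makes `N ×_f G` an extension of `G` by `N`
    (∀ f : SmoothFactorSystem 𝕜 EG EN G N, Nonempty (TwistedLieStructure f)) ∧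
    (∀ (f : SmoothFactorSystem 𝕜 EG EN G N) (L L' : TwistedLieStructure f),
      IsDiffeoOn 𝕜 L.Model L'.Model (fun x : L.Carrier => L'.mk' x.fst x.snd) univ univ) ∧
    (∀ (f : SmoothFactorSystem 𝕜 EG EN G N) (L : TwistedLieStructure f), L.IsExtension) ∧
    -- equivalence of extensions is an equivalence relation
    Equivalence (LieExtension.Equivalent (𝕜 := 𝕜) (EG := EG) (EN := EN) (G := G) (N := N)) ∧
    -- `C^1_s(G,N)` is a group under pointwise multiplication and acts on `Z^2_ss(G,N)`
    ∃ (C : Subgroup (G → N)) (_ : MulAction C (SmoothFactorSystem 𝕜 EG EN G N)),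
      (∀ h : G → N, h ∈ C ↔ IsC1s 𝕜 EG EN h) ∧
      (∀ (h : C) (f : SmoothFactorSystem 𝕜 EG EN G N),
        (h • f).S = actS (h : G → N) f.S ∧ (h • f).ω = actOmega (h : G → N) f.S f.ω) ∧
      -- equivalent extensions correspond to factor systems in the same orbit
      (∀ (f f' : SmoothFactorSystem 𝕜 EG EN G N)
        (L : TwistedLieStructure f) (L' : TwistedLieStructure f')
        (hL : L.IsExtension) (hL' : L'.IsExtension),
        (LieExtension.Equivalent (L.toLieExtension hL) (L'.toLieExtension hL') ↔
          ∃ h : C, h • f = f')) ∧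
      -- the equivalences `N ×_f' G → N ×_f G` are the maps `(n, g) ↦ (n h(g), g)`
      (∀ (f f' : SmoothFactorSystem 𝕜 EG EN G N)
        (L : TwistedLieStructure f) (L' : TwistedLieStructure f'),
        (∀ h : C, h • f = f' → ∃ φ : L'.Carrier →* L.Carrier, L'.IsEquivalence L φ ∧
          ∀ (n : N) (g : G), φ (L'.mk' n g) = L.mk' (n * (h : G → N) g) g) ∧
        (∀ φ : L'.Carrier →* L.Carrier, L'.IsEquivalence L φ →
          ∃ h : C, h • f = f' ∧
            ∀ (n : N) (g : G), φ (L'.mk' n g) = L.mk' (n * (h : G → N) g) g)) ∧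
      -- `(S,ω) ↦ [N ×_(S,ω) G]` induces a bijection `Z^2_ss(G,N) / C^1_s(G,N) → Ext(G,N)`
      ∃ Φ : MulAction.orbitRel.Quotient C (SmoothFactorSystem 𝕜 EG EN G N) →
          LieExt 𝕜 EG EN G N,
        Function.Bijective Φ ∧
        ∀ (f : SmoothFactorSystem 𝕜 EG EN G N) (L : TwistedLieStructure f) (hL : L.IsExtension),
          Φ (Quotient.mk _ f) = Quot.mk _ (L.toLieExtension hL) := by
  have hEquiv := LieExtension.equivalence_equivalent (𝕜 := 𝕜) (EG := EG) (EN := EN) (G := G)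
    (N := N)
  refine ⟨fun f => ⟨f.twistedLieStructure⟩, fun f L L' => L.isDiffeoOn_id L',
    fun f L => L.isExtension, hEquiv, c1sSubgroup 𝕜 EG EN G N, c1sMulAction, fun h => Iff.rfl,
    fun h f => ⟨rfl, rfl⟩, ?_⟩
  let _ := c1sMulAction (𝕜 := 𝕜) (EG := EG) (EN := EN) (G := G) (N := N)
  have hsmul : ∀ (h : c1sSubgroup 𝕜 EG EN G N) (f f' : SmoothFactorSystem 𝕜 EG EN G N),
      h • f = f' ↔ f'.S = actS h.1 f.S ∧ f'.ω = actOmega h.1 f.S f.ω := by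
    intro h f f'
    rw [SmoothFactorSystem.ext_iff, eq_comm, @eq_comm _ _ f'.ω]
    rfl
  have hb : ∀ (f f' : SmoothFactorSystem 𝕜 EG EN G N)
      (L : TwistedLieStructure f) (L' : TwistedLieStructure f'),
      (∀ h : c1sSubgroup 𝕜 EG EN G N, h • f = f' →
        ∃ φ : L'.Carrier →* L.Carrier, L'.IsEquivalence L φ ∧
          ∀ (n : N) (g : G), φ (L'.mk' n g) = L.mk' (n * (h : G → N) g) g) ∧
      (∀ φ : L'.Carrier →* L.Carrier, L'.IsEquivalence L φ →
        ∃ h : c1sSubgroup 𝕜 EG EN G N, h • f = f' ∧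
          ∀ (n : N) (g : G), φ (L'.mk' n g) = L.mk' (n * (h : G → N) g) g) := by
    intro f f' L L'
    refine ⟨fun h hh => ?_, fun φ hφ => ?_⟩
    · obtain ⟨hS, hω⟩ := (hsmul h f f').1 hh
      exact L.exists_isEquivalence L' h.2 hS hω
    · obtain ⟨h, hh, hS, hω, hform⟩ := L.exists_of_isEquivalence L' hφ
      exact ⟨⟨h, hh⟩, (hsmul _ f f').2 ⟨hS, hω⟩, hform⟩
  have ha : ∀ (f f' : SmoothFactorSystem 𝕜 EG EN G N)
      (L : TwistedLieStructure f) (L' : TwistedLieStructure f')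
      (hL : L.IsExtension) (hL' : L'.IsExtension),
      (LieExtension.Equivalent (L.toLieExtension hL) (L'.toLieExtension hL') ↔
        ∃ h : c1sSubgroup 𝕜 EG EN G N, h • f = f') := by
    intro f f' L L' hL hL'
    constructor
    · intro h
      -- The description of equivalences concerns maps from the `f'`-product to the `f`-product, the
      -- opposite direction; invertibility of equivalences bridges this.
      obtain ⟨φ, hφ⟩ := hEquiv.symm h
      obtain ⟨h, hh, -⟩ := (hb f f' L L').2 φ hφ
      exact ⟨h, hh⟩
    · rintro ⟨h, hh⟩
      obtain ⟨φ, hφ, -⟩ := (hb f f' L L').1 h hh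
      exact hEquiv.symm ⟨φ, hφ⟩
  refine ⟨ha, hb, ?_⟩
  let E₀ : SmoothFactorSystem 𝕜 EG EN G N → LieExtension 𝕜 EG EN G N := fun f =>
    f.twistedLieStructure.toLieExtension f.twistedLieStructure.isExtension
  refine ⟨Quotient.lift (fun f => (Quot.mk _ (E₀ f) : LieExt 𝕜 EG EN G N)) ?_, ⟨?_, ?_⟩, ?_⟩
  · rintro f f' hff'
    obtain ⟨h, hh⟩ := MulAction.orbitRel_apply.1 hff'
    exact Quot.sound (hEquiv.symm ((ha f' f _ _ _ _).2 ⟨h, hh⟩))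
  · intro x y
    refine Quotient.inductionOn₂ x y fun f f' hff' => ?_
    -- Equality in `Quot` yields only the generated equivalence relation, which collapses because
    -- `Equivalent` already is one.
    obtain ⟨h, hh⟩ := (ha f f' _ _ _ _).1 (hEquiv.eqvGen_iff.1 (Quot.eqvGen_exact hff'))
    exact Quotient.sound ((MulAction.orbitRel _ _).symm (MulAction.orbitRel_apply.2 ⟨h, hh⟩))
  · intro x
    induction x using Quot.ind with
    | mk X =>
      obtain ⟨f, hf⟩ := X.isExtension.exists_factorSystem
      exact ⟨Quotient.mk _ f, Quot.sound (hf _)⟩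
  · intro f L hL
    -- The class does not depend on the chosen Lie group structure: `h = 1` relates any two
    -- structures for the same `f`.
    exact Quot.sound ((ha f f _ _ _ _).2 ⟨1, one_smul _ _⟩)
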